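/- Let $k$ be a field with the trivial norm, $X$ a variety over $k$ (a separated integral scheme of finite type over $k$), and $p\in X$ a (not necessarily closed) point whose local ring $\mathscr O_{X,p}$ is regular, of dimension $m$. Let $f_1,\dots,f_m$ generate the maximal ideal of $\mathscr O_{X,p}$, and let $\widehat{\mathscr O_{X,p}}\cong\kappa(p)[[t_1,\dots,t_m]]$ be a ring isomorphism that sends $f_i$ to $t_i$ and induces the identity on the residue field $\kappa(p)$. Let $r_1,\dots,r_m\in(0,1)$, and let $x\in X^{\mathrm{an}}$ be the corresponding monomial valuation: the point of the Berkovich analytification given by the absolute value on the function field $K(X)$ such that, for $0\ne a\in\mathscr O_{X,p}$ with image $\sum_I a_I t^I$ in $\kappa(p)[[t_1,\dots,t_m]]$, $$|a|_x=\max_{a_I\neq 0} r_1^{i_1}\cdots r_m^{i_m}.$$ Let $\mathscr H(x)$ be the completion of $K(X)$ with respect to $|\cdot|_x$, let $\mathscr H(x)^\circ=\{f\in\mathscr H(x) : |f|_x\le 1\}$, and let $\widetilde{\mathscr H(x)}$ be the residue field of the valuation ring $\mathscr H(x)^\circ$ (the double residue field). For $\pi:Y\to X$ the identity or a blow-up along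 a nonzero ideal sheaf, the center $c_Y(x)$ is the image of the closed point under the morphism $\operatorname{Spec}\mathscr H(x)^\circ\to Y$ that lifts, through $\pi$, the canonical morphism $\operatorname{Spec}\mathscr H(x)\to X$; this morphism induces the canonical inclusion $\kappa(c_Y(x))\hookrightarrow\widetilde{\mathscr H(x)}$. Let $r$ be the rational rank of $x$, that is, the dimension over $\mathbb Q$ of $|\mathscr H(x)^\times|\otimes_{\mathbb Z}\mathbb Q$. Then: 1. The center of $x$ on $X$ exists, $c_X(x)=p$, and $\widetilde{\mathscr H(x)}$ is finitely generated as a field over $\kappa(c_X(x))$. 2. Let $\Lambda=\{I\in\mathbb Z^m : r_1^{i_1}\cdots r_m^{i_m}=1\}$. The residue classes of the Laurent monomials $f^I=f_1^{i_1}\cdots f_m^{i_m}$, $I\in\Lambda$, define an injective homomorphism of $\kappa(c_X(x))$-algebras from the group ring $\kappa(c_X(x))[\Lambda]$ to $\widetilde{\mathscr H(x)}$, whose field of fractions is $\widetilde{\mathscr H(x)}$. Moreover $r$ is finite, $r\le m$, and $\widetilde{\mathscr H(x)}$ is isomorphic over $\kappa(c_X(x))$ to a rational function field in $m-r$ variables.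 3. There is a blow-up $\pi:X'\to X$ along a nonzero ideal sheaf such that the center $c_{X'}(x)$ exists and the canonical inclusion $\kappa(c_{X'}(x))\hookrightarrow\widetilde{\mathscr H(x)}$ is an isomorphism, that is, $\widetilde{\mathscr H(x)}=\kappa(c_{X'}(x))$. -/

import Mathlib

open CategoryTheory AlgebraicGeometry

universe u

noncomputable section

/-! ### Complete non-Archimedean fields -/

/-- The completion of a field at a non-Archimedean absolute value is non-Archimedean. -/
theorem completion_isUltrametricDist {K : Type u} [Field K] (v : AbsoluteValue K ℝ)
    (hv : IsNonarchimedean v) : IsUltrametricDist v.Completion := by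
  refine IsUltrametricDist.isUltrametricDist_of_isNonarchimedean_norm fun a b => ?_
  induction a, b using UniformSpace.Completion.induction_on₂ with
  | hp => exact isClosed_le (by fun_prop) (by fun_prop)
  | ih a b =>
    rw [← UniformSpace.Completion.coe_add]
    simp only [UniformSpace.Completion.norm_coe]
    exact hv (WithAbs.ofAbs a) (WithAbs.ofAbs b)

/-! ### Berkovich points over a trivially valued field -/

/-- The structure map `k → κ(p)` of the residue field of a point of a `k`-scheme. -/
def scalarToResidueField {k : Type u} [Field k] {X : Scheme.{u}} (s : X ⟶ Spec (.of k)) (p : X) :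
    k →+* X.residueField p :=
  (Spec.preimage (X.fromSpecResidueField p ≫ s)).hom

/-- A point of the Berkovich analytification `X^an` of a scheme `X` over a trivially valued field
`k`: a point `pt` of `X` together with a multiplicative non-Archimedean norm on its residue field
extending the trivial norm of `k`. (On an affine open `Spec A`, these are the multiplicative
seminorms on `A` that are trivial on `k`; `pt` is the kernel of the seminorm.) -/
structure BerkovichPoint {k : Type u} [Field k] {X : Scheme.{u}} (s : X ⟶ Spec (.of k)) where
  /-- the underlying point of `X`, that is, the kernel of the seminorm -/
  pt : X
  /-- the norm on the residue field of that point -/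
  abv : AbsoluteValue (X.residueField pt) ℝ
  nonarch : IsNonarchimedean abv
  abv_scalar : ∀ a : k, a ≠ 0 → abv (scalarToResidueField s pt a) = 1

namespace BerkovichPoint

variable {k : Type u} [Field k] {X : Scheme.{u}} {s : X ⟶ Spec (.of k)} (x : BerkovichPoint s)

/-- The Berkovich residue field `ℋ(x)`. -/
abbrev H : Type u := x.abv.Completion

instance : IsUltrametricDist x.H := completion_isUltrametricDist x.abv x.nonarch

/-- The embedding `κ(pt) → ℋ(x)`. -/
def toH : X.residueField x.pt →+* x.H :=
  (UniformSpace.Completion.coeRingHom (α := WithAbs x.abv)).comp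
    (WithAbs.equiv x.abv).symm.toRingHom

/-- The valuation ring `ℋ(x)° = {f | ‖f‖ ≤ 1}`. -/
abbrev integers : ValuationSubring x.H := (NormedField.valuation (K := x.H)).valuationSubring

theorem mem_integers (f : x.H) : f ∈ x.integers ↔ ‖f‖ ≤ 1 := by
  rw [Valuation.mem_valuationSubring_iff, NormedField.valuation_apply, ← NNReal.coe_le_coe]
  rfl

/-- The double residue field of `x`, the residue field of the valuation ring `ℋ(x)°`. -/
abbrev DoubleResidueField : Type u := IsLocalRing.ResidueField x.integers

/-- The `ℚ`-vector space `√|ℋ(x)ˣ|`, written additively by means of the logarithm: the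
`ℚ`-subspace of `ℝ` spanned by the `log ‖f‖`, `f ∈ ℋ(x)ˣ`. Its dimension is the rational rank. -/
def valueSpace : Submodule ℚ ℝ :=
  Submodule.span ℚ (Set.range fun f : x.Hˣ => Real.log ‖(f : x.H)‖)

/-- The canonical morphism `Spec ℋ(x) ⟶ X`. -/
def toScheme : Spec (.of x.H) ⟶ X :=
  Spec.map (CommRingCat.ofHom x.toH) ≫ X.fromSpecResidueField x.pt

/-- The morphism `Spec ℋ(x) ⟶ Spec ℋ(x)°`. -/
def specInclusion : Spec (.of x.H) ⟶ Spec (.of x.integers) :=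
  Spec.map (CommRingCat.ofHom x.integers.subtype)

/-- The datum of the center of `x` on `Y`, for a morphism `π : Y ⟶ X`: a morphism
`Spec ℋ(x)° ⟶ Y` which, composed with `π`, extends the canonical morphism `Spec ℋ(x) ⟶ X`.
For `π = 𝟙 X` this defines the center of `x` on `X`. When `π` is birational and `x` is a
valuation, `Spec ℋ(x) ⟶ X` has only one lift to `Y`, the canonical morphism for `x` viewed as a
valuation on `Y`, and this defines the center of `x` on `Y`. The datum is unique when `Y` is
separated over the base. -/
structure CenterOn {Y : Scheme.{u}} (π : Y ⟶ X) where
  /-- the morphism from the spectrum of the valuation ring -/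
  hom : Spec (.of x.integers) ⟶ Y
  comm : x.specInclusion ≫ hom ≫ π = x.toScheme

namespace CenterOn

variable {x} {Y : Scheme.{u}} {π : Y ⟶ X} (c : x.CenterOn π)

/-- The center: the image of the closed point of `Spec ℋ(x)°`. -/
def center : Y := c.hom (IsLocalRing.closedPoint x.integers)

/-- The local homomorphism from the local ring of `Y` at the center to `ℋ(x)°`. -/
def stalkToIntegers : Y.presheaf.stalk c.center →+* x.integers :=
  (Scheme.stalkClosedPointTo (R := .of x.integers) c.hom).hom

instance : IsLocalHom c.stalkToIntegers :=
  Scheme.isLocalHom_stalkClosedPointTo' c.hom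

/-- The canonical inclusion of the residue field of the center in the double residue field. -/
def residueMap : Y.residueField c.center →+* x.DoubleResidueField :=
  IsLocalRing.ResidueField.map c.stalkToIntegers

end CenterOn

/-- The homomorphism `𝒪_{X,p} → κ(pt)` when `p` is a specialization of the underlying point. -/
def stalkToField {p : X} (h : x.pt ⤳ p) : X.presheaf.stalk p →+* X.residueField x.pt :=
  (X.presheaf.stalkSpecializes h ≫ X.residue x.pt).hom

end BerkovichPoint

/-! ### Monomial valuations -/

/-- A system of algebraic coordinates `(f_1, …, f_m)` at the point `p`, with `m = dim 𝒪_{X,p}`,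
and an isomorphism of the completed local ring with `κ(p)⟦t_1, …, t_m⟧` sending `f_i` to `t_i` and
inducing the identity on the residue field `κ(p)`. (The inverse of the isomorphism, restricted to
the constants, is a ring homomorphism from `κ(p)` to the completed local ring that splits the
residue map, and the isomorphism is one of `κ(p)`-algebras.) -/
structure CohenCoordinates (X : Scheme.{u}) (p : X) (m : ℕ) where
  /-- the coordinates -/
  coord : Fin m → X.presheaf.stalk p
  span_coord :
    Ideal.span (Set.range coord) = IsLocalRing.maximalIdeal (X.presheaf.stalk p)
  dim_eq : ringKrullDim (X.presheaf.stalk p) = m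
  /-- the isomorphism of the completed local ring with the power series ring -/
  iso : AdicCompletion (IsLocalRing.maximalIdeal (X.presheaf.stalk p)) (X.presheaf.stalk p) ≃+*
    MvPowerSeries (Fin m) (X.residueField p)
  iso_coord : ∀ i, iso (algebraMap _ _ (coord i)) = MvPowerSeries.X i
  iso_residue : ∀ a : X.presheaf.stalk p,
    MvPowerSeries.constantCoeff (iso (algebraMap _ _ a)) = (X.residue p).hom a

/-- `x` is the monomial valuation at `p` with the given coordinates and Cohen isomorphism and with
weights `r_i ∈ (0, 1)`: it is a norm on the function field, and if `∑ a_I f^I` is the expansion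
of a nonzero `a ∈ 𝒪_{X,p}`, then `|a| = max {r^I | a_I ≠ 0}`. -/
structure BerkovichPoint.IsMonomial {k : Type u} [Field k] {X : Scheme.{u}} [IsIntegral X]
    {s : X ⟶ Spec (.of k)} (x : BerkovichPoint s) {p : X} {m : ℕ} (D : CohenCoordinates X p m)
    (r : Fin m → ℝ) : Prop where
  pos : ∀ i, 0 < r i
  lt_one : ∀ i, r i < 1
  pt_eq : x.pt = genericPoint X
  specializes : x.pt ⤳ p
  isGreatest : ∀ a : X.presheaf.stalk p, a ≠ 0 →
    IsGreatest {t : ℝ | ∃ I : Fin m →₀ ℕ,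
        MvPowerSeries.coeff I (D.iso (algebraMap _ _ a)) ≠ 0 ∧ t = ∏ i, r i ^ I i}
      (x.abv (x.stalkToField specializes a))

/-- The group of multiplicative relations between the weights, `{I ∈ ℤ^m | r^I = 1}` (for positive
`r`), written with logarithms. -/
def weightRelations {m : ℕ} (r : Fin m → ℝ) : AddSubgroup (Fin m → ℤ) where
  carrier := {I | ∑ i, (I i : ℝ) * Real.log (r i) = 0}
  zero_mem' := by simp
  add_mem' {I J} hI hJ := by
    simp only [Set.mem_ofPred_eq] at hI hJ ⊢
    simp [add_mul, Finset.sum_add_distrib, hI, hJ]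
  neg_mem' {I} hI := by
    simp only [Set.mem_ofPred_eq] at hI ⊢
    simp [hI]

/-- The Laurent monomial `f^I`, `I ∈ ℤ^m`, as an element of `ℋ(x)`. -/
def BerkovichPoint.laurentMonomial {k : Type u} [Field k] {X : Scheme.{u}}
    {s : X ⟶ Spec (.of k)} (x : BerkovichPoint s) {p : X} (h : x.pt ⤳ p) {m : ℕ}
    (D : CohenCoordinates X p m) (I : Fin m → ℤ) : x.H :=
  ∏ i, x.toH (x.stalkToField h (D.coord i)) ^ I i

/-! ### Blow-ups -/

/-- An ideal sheaf is invertible if it is locally generated by one nonzerodivisor. -/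
def IsInvertibleIdealSheaf {Z : Scheme.{u}} (I : Z.IdealSheafData) : Prop :=
  ∀ z : Z, ∃ U : Z.affineOpens, z ∈ U.1 ∧
    ∃ a ∈ nonZeroDivisors Γ(Z, U.1), I.ideal U = Ideal.span {a}

/-- `π : Y ⟶ X` is the blow-up of `X` along the (quasi-coherent) ideal sheaf `I`: the inverse image
ideal sheaf `π⁻¹I · 𝒪_Y` is invertible, and `π` is universal with this property. -/
structure IsBlowup {Y X : Scheme.{u}} (π : Y ⟶ X) (I : X.IdealSheafData) : Prop where
  invertible : IsInvertibleIdealSheaf (I.comap π)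
  universal : ∀ (Z : Scheme.{u}) (g : Z ⟶ X), IsInvertibleIdealSheaf (I.comap g) →
    ∃! h : Z ⟶ Y, h ≫ π = g

end

/-!
The local ring `O = 𝒪_{X,p}` maps to `ℋ(x)` in such a way that `‖a‖` is the largest weight `r^I` of
a monomial in the power series expansion of `a`, and quotients of elements of `O` are dense. This is
recorded by `MonomialEmbedding`, and the statements about the double residue field `k` follow
from it alone.

* Every norm is that of a quotient of elements of `O`, hence in the group generated by the `r_i`.
  So the value space is spanned by the `log r_i` (`MonomialEmbedding.span_log_norm`), and rank-nullity
  for `ℤ^m → ℝ`, `I ↦ ∑ i_j log r_j`, compares its dimension `n` with the rank `m - n` of the kernel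
  `Λ` (`exists_basis_weightRelations`).
* An element `a ≠ 0` of `O` agrees, up to smaller terms, with the finite sum of its monomials of
  weight `‖a‖` (`MonomialEmbedding.exists_leading_form`). Dividing by one of these monomials
  gives a combination of Laurent monomials `f^I` with `I ∈ Λ`, so `k` consists of quotients of
  elements of the group ring of `Λ` (`MonomialEmbedding.exists_div_eq`). The expansion being a formal
  power series, different monomials of equal weight cannot cancel, and the group ring embeds in `k`
  (`MonomialEmbedding.groupRingHom_injective`).
* For a basis `b_1, …, b_d` of `Λ`, the residue classes of the `f^{b_j}` are therefore algebraically
  independent and generate `k` over `κ(p)` (`MonomialEmbedding.nonempty_algEquiv`).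

The center is `p` because `O → ℋ(x)°` is a local homomorphism. For the last part, choose a monomial
`g` such that all `h_j = g f^{b_j}` are monomials, and blow up the ideal sheaf of the sections that
are multiples of `g` in `ℋ(x)°`. It contains `g` and the `h_j`, and is generated by `g` on
`Spec ℋ(x)°`, so the lift of `Spec ℋ(x)° → X` goes to a chart of the blow-up in which the `h_j / g`
are regular functions (`BerkovichPoint.CenterOn.exists_blowup`). The residue field of the new center
thus contains the generators of `k` over `κ(p)`.

The blow-up of an arbitrary scheme along an arbitrary ideal sheaf is constructed from its universal
property. A chart is given by an affine open `U` and a finite nonempty set `S` of sections of the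
ideal `J` over `U`; its ring is the affine blow-up algebra `Γ(X, U)[h / s : h ∈ J, s ∈ S]`, and it
represents the morphisms to `X` for which all elements of `S` become nonzerodivisors that generate
the inverse image of `J` (`BlowupConstruction.Chart.Good.existsUnique_lift`). This property makes the
charts an open, locally directed diagram, whose colimit is the blow-up
(`BlowupConstruction.isBlowup_blowupProj`).
-/

noncomputable section

/-! ### Sections that generate an inverse image ideal -/

namespace BlowupConstruction

variable {X Z W : Scheme.{u}}

theorem res_res (X : Scheme.{u}) {U V T : X.Opens} (h : V ≤ U) (h' : T ⟶ V) (a : Γ(X, U)) :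
    X.presheaf.map h'.op (X.presheaf.map (homOfLE h).op a) =
      X.presheaf.map (homOfLE (h'.le.trans h)).op a := by
  rw [← CommRingCat.comp_apply, ← Functor.map_comp]
  rfl

/-- The ring homomorphism sending a section over `U` to the germ at `z` of its pullback. -/
def sectionGerm (f : Z ⟶ X) (U : X.Opens) (z : Z) (hz : f z ∈ U) :
    Γ(X, U) →+* Z.presheaf.stalk z :=
  (f.app U ≫ Z.presheaf.germ (f ⁻¹ᵁ U) z hz).hom

theorem sectionGerm_apply (f : Z ⟶ X) (U : X.Opens) (z : Z) (hz : f z ∈ U) (a : Γ(X, U)) :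
    sectionGerm f U z hz a = Z.presheaf.germ (f ⁻¹ᵁ U) z hz (f.app U a) := rfl

theorem sectionGerm_comp_res (f : Z ⟶ X) {U V : X.Opens} (h : V ≤ U) (z : Z) (hz : f z ∈ V) :
    (sectionGerm f V z hz).comp (X.presheaf.map (homOfLE h).op).hom =
      sectionGerm f U z (h hz) := by
  rw [sectionGerm, sectionGerm, ← CommRingCat.hom_comp, f.naturality_assoc]
  congr 2
  exact Z.presheaf.germ_res _ _ _

theorem sectionGerm_res (f : Z ⟶ X) {U V : X.Opens} (h : V ≤ U) (z : Z) (hz : f z ∈ V)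
    (a : Γ(X, U)) :
    sectionGerm f V z hz (X.presheaf.map (homOfLE h).op a) = sectionGerm f U z (h hz) a :=
  RingHom.congr_fun (sectionGerm_comp_res f h z hz) a

theorem sectionGerm_comp (e : W ⟶ Z) (f : Z ⟶ X) (U : X.Opens) (w : W) (hw : (e ≫ f) w ∈ U)
    (hw' : f (e w) ∈ U) (a : Γ(X, U)) :
    sectionGerm (e ≫ f) U w hw a = (e.stalkMap w).hom (sectionGerm f U (e w) hw' a) := by
  exact (Scheme.Hom.germ_stalkMap_apply e (f ⁻¹ᵁ U) w hw (f.app U a)).symm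

/-- The section `g` of `I` over the affine open `U` pulls back to a generator, and a
nonzerodivisor, of the inverse image ideal of `I` in the local ring at `z`. -/
def IsGenAt (I : X.IdealSheafData) (f : Z ⟶ X) (U : X.affineOpens) (g : Γ(X, U)) (z : Z) : Prop :=
  ∃ hz : f z ∈ U.1, sectionGerm f U z hz g ∈ nonZeroDivisors (Z.presheaf.stalk z) ∧
    ∀ h ∈ I.ideal U, sectionGerm f U z hz g ∣ sectionGerm f U z hz h

variable {I : X.IdealSheafData}

theorem exists_affine_le_inf {U V : X.Opens} {x : X} (hU : x ∈ U) (hV : x ∈ V) :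
    ∃ T : X.affineOpens, x ∈ T.1 ∧ T.1 ≤ U ∧ T.1 ≤ V := by
  obtain ⟨_, ⟨T, hT, rfl⟩, hxT, hTU⟩ := X.isBasis_affineOpens.exists_subset_of_mem_open
    (show x ∈ U ⊓ V from ⟨hU, hV⟩) (U ⊓ V).2
  exact ⟨⟨T, hT⟩, hxT, fun y hy => (hTU hy).1, fun y hy => (hTU hy).2⟩

/-- The ideal of a local ring generated by the germs of `I` can be computed on any affine open. -/
theorem sectionGerm_mem_map (I : X.IdealSheafData) (f : Z ⟶ X) {U V : X.affineOpens} {z : Z}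
    (hz : f z ∈ U.1) (hV : f z ∈ V.1) {h : Γ(X, V)} (hh : h ∈ I.ideal V) :
    sectionGerm f V z hV h ∈ (I.ideal U).map (sectionGerm f U z hz) := by
  obtain ⟨T, hxT, hTU, hTV⟩ := exists_affine_le_inf hz hV
  have h1 : X.presheaf.map (homOfLE hTV).op h ∈ I.ideal T := by
    rw [← I.map_ideal' (homOfLE hTV).op]
    exact Ideal.mem_map_of_mem _ hh
  rw [← I.map_ideal' (homOfLE hTU).op] at h1
  have h2 := Ideal.mem_map_of_mem (sectionGerm f T z hxT) h1
  rwa [Ideal.map_map, sectionGerm_comp_res, sectionGerm_res f hTV] at h2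

theorem IsGenAt.dvd {f : Z ⟶ X} {U : X.affineOpens} {g : Γ(X, U)} {z : Z}
    (H : IsGenAt I f U g z) {V : X.affineOpens} (hV : f z ∈ V.1) {h : Γ(X, V)}
    (hh : h ∈ I.ideal V) : sectionGerm f U z H.choose g ∣ sectionGerm f V z hV h := by
  rw [← Ideal.mem_span_singleton]
  refine (Ideal.map_le_iff_le_comap.2 ?_) (sectionGerm_mem_map I f H.choose hV hh)
  intro a ha
  rw [Ideal.mem_comap, Ideal.mem_span_singleton]
  exact H.choose_spec.2 a ha

/-- Restricting a generator to a smaller affine open. -/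
theorem IsGenAt.res {f : Z ⟶ X} {U V : X.affineOpens} {g : Γ(X, U)} {z : Z}
    (H : IsGenAt I f U g z) (hVU : V.1 ≤ U.1) (hz : f z ∈ V.1) :
    IsGenAt I f V (X.presheaf.map (homOfLE hVU).op g) z := by
  refine ⟨hz, ?_, fun h hh => ?_⟩
  · rw [sectionGerm_res]; exact H.choose_spec.1
  · rw [sectionGerm_res]; exact H.dvd hz hh

theorem IsGenAt.of_res {f : Z ⟶ X} {U V : X.affineOpens} {g : Γ(X, U)} {z : Z}
    (hVU : V.1 ≤ U.1) (H : IsGenAt I f V (X.presheaf.map (homOfLE hVU).op g) z) :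
    IsGenAt I f U g z := by
  refine ⟨hVU H.choose, ?_, fun h hh => ?_⟩
  · have := H.choose_spec.1
    rwa [sectionGerm_res] at this
  · have := H.dvd (hVU H.choose) hh
    rwa [sectionGerm_res] at this

/-- Being a generator can be tested after restriction along an open immersion. -/
theorem isGenAt_comp_iff (e : W ⟶ Z) [IsOpenImmersion e] (f : Z ⟶ X) (U : X.affineOpens)
    (g : Γ(X, U)) (w : W) : IsGenAt I (e ≫ f) U g w ↔ IsGenAt I f U g (e w) := by
  let E : Z.presheaf.stalk (e w) ≃+* W.presheaf.stalk w :=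
    (asIso (e.stalkMap w)).commRingCatIsoToRingEquiv
  have key : ∀ (hw : (e ≫ f) w ∈ U.1) (hw' : f (e w) ∈ U.1) (a : Γ(X, U)),
      sectionGerm (e ≫ f) U w hw a = E (sectionGerm f U (e w) hw' a) :=
    fun hw hw' a => sectionGerm_comp e f U w hw hw' a
  have h1 : ∀ a, E a ∈ nonZeroDivisors (W.presheaf.stalk w) ↔
      a ∈ nonZeroDivisors (Z.presheaf.stalk (e w)) := fun a => by
    rw [← MulEquivClass.map_nonZeroDivisors E]
    exact ⟨fun ⟨b, hb, hba⟩ => E.injective hba ▸ hb, fun ha => ⟨a, ha, rfl⟩⟩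
  constructor
  · rintro ⟨hw, hg, hd⟩
    have hw' : f (e w) ∈ U.1 := hw
    rw [key hw hw', h1] at hg
    refine ⟨hw', hg, fun h hh => ?_⟩
    have := hd h hh
    rwa [key hw hw', key hw hw', map_dvd_iff] at this
  · rintro ⟨hw', hg, hd⟩
    have hw : (e ≫ f) w ∈ U.1 := hw'
    refine ⟨hw, ?_, fun h hh => ?_⟩
    · rwa [key hw hw', h1]
    · rw [key hw hw', key hw hw', map_dvd_iff]
      exact hd h hh

/-- If a generator `s` of the inverse image ideal at `e w` and a section `t` of `I` become
generators at `w` after composing with `e`, then `t` is already a generator at `e w`. -/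
theorem IsGenAt.of_comp {e : W ⟶ Z} {f : Z ⟶ X} {U V : X.affineOpens} {s : Γ(X, U)}
    {t : Γ(X, V)} (hs : s ∈ I.ideal U) (ht : t ∈ I.ideal V) {w : W} (H : IsGenAt I f U s (e w))
    (H' : IsGenAt I (e ≫ f) V t w) (H'' : IsGenAt I (e ≫ f) U s w) :
    IsGenAt I f V t (e w) := by
  have hV : f (e w) ∈ V.1 := H'.choose
  have hU : f (e w) ∈ U.1 := H.choose
  obtain ⟨c, hc⟩ := H.dvd hV ht
  obtain ⟨d, hd⟩ := H'.dvd hU hs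
  -- the quotient `t / s` at `e w` becomes a unit at `w`, and `e` is local on stalks
  have hcu : IsUnit c := by
    have h1 := congrArg (e.stalkMap w).hom hc
    rw [map_mul, ← sectionGerm_comp e f _ w H'.choose, ← sectionGerm_comp e f _ w H''.choose] at h1
    rw [h1, mul_assoc] at hd
    have h2 : (e.stalkMap w).hom c * d = 1 := by
      have h3 := H''.choose_spec.1
      rw [← mul_cancel_left_mem_nonZeroDivisors h3, mul_one]
      exact hd.symm
    exact (isUnit_map_iff (e.stalkMap w).hom c).1 (IsUnit.of_mul_eq_one _ h2)
  refine ⟨hV, ?_, fun h hh => ?_⟩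
  · rw [hc]
    exact mul_mem H.choose_spec.1 hcu.mem_nonZeroDivisors
  · rw [hc, hcu.mul_right_dvd]
    exact H.dvd hV hh

/-- The locus where a section of `I` is a generator is open inside the locus where another section
is. -/
theorem IsGenAt.eventually {f : Z ⟶ X} {U V : X.affineOpens} {s : Γ(X, U)}
    {t : Γ(X, V)} (hs : s ∈ I.ideal U) (ht : t ∈ I.ideal V) (H : ∀ z, IsGenAt I f U s z) {z : Z}
    (H' : IsGenAt I f V t z) : ∃ N : Z.Opens, z ∈ N ∧ ∀ y ∈ N, IsGenAt I f V t y := by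
  have hV : f z ∈ V.1 := H'.choose
  have hU : f z ∈ U.1 := (H z).choose
  obtain ⟨c, hc⟩ := (H z).dvd hV ht
  obtain ⟨d, hd⟩ := H'.dvd hU hs
  have hcd : c * d = 1 := by
    rw [hc, mul_assoc] at hd
    rw [← mul_cancel_left_mem_nonZeroDivisors (H z).choose_spec.1, mul_one]
    exact hd.symm
  -- the unit `c = t / s` at `z` extends to a unit on a neighbourhood, where still `t = s * c`
  obtain ⟨N, hzN, c, rfl⟩ := Z.presheaf.exists_germ_eq c
  rw [sectionGerm_apply, sectionGerm_apply] at hc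
  obtain ⟨N', hzN', hN'⟩ : ∃ (N' : Z.Opens) (_ : z ∈ N'), ∃ (h1 : N' ≤ f ⁻¹ᵁ V.1)
      (h2 : N' ≤ f ⁻¹ᵁ U.1) (h3 : N' ≤ N), Z.presheaf.map (homOfLE h1).op (f.app V t) =
        Z.presheaf.map (homOfLE h2).op (f.app U s) * Z.presheaf.map (homOfLE h3).op c := by
    let N₀ : Z.Opens := f ⁻¹ᵁ V.1 ⊓ f ⁻¹ᵁ U.1 ⊓ N
    have hN₀ : z ∈ N₀ := ⟨⟨hV, hU⟩, hzN⟩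
    have a1 : N₀ ≤ f ⁻¹ᵁ V.1 := fun y hy => hy.1.1
    have a2 : N₀ ≤ f ⁻¹ᵁ U.1 := fun y hy => hy.1.2
    have a3 : N₀ ≤ N := fun y hy => hy.2
    obtain ⟨N', hz', i, j, hij⟩ := Z.presheaf.germ_eq z hN₀ hN₀
      (Z.presheaf.map (homOfLE a1).op (f.app V t))
      (Z.presheaf.map (homOfLE a2).op (f.app U s) * Z.presheaf.map (homOfLE a3).op c) (by
        rw [map_mul, Z.presheaf.germ_res_apply, Z.presheaf.germ_res_apply,
          Z.presheaf.germ_res_apply]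
        exact hc)
    refine ⟨N', hz', i.le.trans a1, i.le.trans a2, i.le.trans a3, ?_⟩
    rw [map_mul] at hij
    simpa only [res_res] using hij
  obtain ⟨h1, h2, h3, heq⟩ := hN'
  refine ⟨N' ⊓ Z.basicOpen c, ⟨hzN', ?_⟩, fun y hy => ?_⟩
  · exact (Z.mem_basicOpen c z hzN).2 (IsUnit.of_mul_eq_one _ hcd)
  have hyc : IsUnit (Z.presheaf.germ N y (h3 hy.1) c) := (Z.mem_basicOpen c y (h3 hy.1)).1 hy.2
  have hVy : f y ∈ V.1 := h1 hy.1
  have hUy : f y ∈ U.1 := h2 hy.1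
  have hg : sectionGerm f V y hVy t =
      sectionGerm f U y hUy s * Z.presheaf.germ N y (h3 hy.1) c := by
    have := congrArg (Z.presheaf.germ N' y hy.1) heq
    rw [map_mul, Z.presheaf.germ_res_apply, Z.presheaf.germ_res_apply,
          Z.presheaf.germ_res_apply] at this
    exact this
  refine ⟨hVy, ?_, fun h hh => ?_⟩
  · rw [hg]
    exact mul_mem (H y).choose_spec.1 hyc.mem_nonZeroDivisors
  · rw [hg, hyc.mul_right_dvd]
    exact (H y).dvd hVy hh

end BlowupConstruction

/-! ### Affine blow-up algebras and divisibility of sections -/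

namespace BlowupConstruction

section Algebra

variable {A : Type u} [CommRing A]

/-- The affine blow-up algebra `A[h / s : h ∈ J, s ∈ S]`, as a subalgebra of the localization of
`A` at the elements of `S`. For nonempty
`S ⊆ J` its spectrum is the open subscheme of the blow-up of
`Spec A` along `J` on which every `s ∈ S` generates the inverse image of `J`. -/
def blowupAlgebra (J : Ideal A) (S : Set A) :
    Subalgebra A (Localization (Submonoid.closure S)) :=
  Algebra.adjoin A {b | ∃ h ∈ J, ∃ s ∈ S, b * algebraMap A _ s = algebraMap A _ h}

variable {J : Ideal A} {S : Set A}

theorem isUnit_algebraMap_closure {s : A} (hs : s ∈ S) :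
    IsUnit (algebraMap A (Localization (Submonoid.closure S)) s) :=
  IsLocalization.map_units (M := Submonoid.closure S) _ ⟨s, Submonoid.subset_closure hs⟩

theorem blowupAlgebra_mem_nonZeroDivisors {s : A} (hs : s ∈ S) :
    algebraMap A (blowupAlgebra J S) s ∈ nonZeroDivisors (blowupAlgebra J S) := by
  refine mem_nonZeroDivisors_iff_right.2 fun b hb => Subtype.ext ?_
  have h1 : (b : Localization (Submonoid.closure S)) * algebraMap A _ s = 0 :=
    congrArg Subtype.val hb
  exact (isUnit_algebraMap_closure hs).mul_left_eq_zero.1 h1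

theorem blowupAlgebra_exists_mul_eq {s h : A} (hs : s ∈ S) (hh : h ∈ J) :
    ∃ b : blowupAlgebra J S, b * algebraMap A _ s = algebraMap A _ h := by
  obtain ⟨u, hu⟩ := isUnit_algebraMap_closure hs
  have h1 : algebraMap A (Localization (Submonoid.closure S)) h * (u⁻¹ : _ˣ) *
      algebraMap A _ s = algebraMap A _ h := by
    rw [← hu, mul_assoc, Units.inv_mul, mul_one]
  exact ⟨⟨_, Algebra.subset_adjoin ⟨h, hh, s, hs, h1⟩⟩, Subtype.ext h1⟩

/-- The universal property of the affine blow-up algebra. -/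
theorem existsUnique_blowupAlgebra_lift {C : Type*} [CommRing C] (φ : A →+* C)
    (h₁ : ∀ s ∈ S, φ s ∈ nonZeroDivisors C) (h₂ : ∀ s ∈ S, ∀ h ∈ J, φ s ∣ φ h) :
    ∃! β : blowupAlgebra J S →+* C, β.comp (algebraMap A _) = φ := by
  refine existsUnique_of_exists_of_unique ?_ ?_
  · have hle : Submonoid.closure S ≤ (nonZeroDivisors C).comap φ := by
      rw [Submonoid.closure_le]; exact h₁
    -- the lift exists with values in the total ring of fractions `T`, and lands in `C` because the
    -- generators do
    let T := Localization (nonZeroDivisors C)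
    have hinj : Function.Injective (algebraMap C T) := IsLocalization.injective T le_rfl
    let ψ : Localization (Submonoid.closure S) →+* T :=
      IsLocalization.map (M := Submonoid.closure S) T φ hle
    have hψ : ∀ a : A, ψ (algebraMap A _ a) = algebraMap C T (φ a) :=
      fun a => IsLocalization.map_eq hle a
    have hmem : ∀ b : blowupAlgebra J S, ψ b ∈ (algebraMap C T).range := by
      rintro ⟨b, hb⟩
      induction hb using Algebra.adjoin_induction with
      | mem b hb =>
        obtain ⟨h, hh, s, hs, e⟩ := hb
        obtain ⟨c, hc⟩ := h₂ s hs h hh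
        have e' := congrArg ψ e
        rw [map_mul, hψ, hψ, hc, map_mul, mul_comm] at e'
        refine ⟨c, ?_⟩
        have hu : IsUnit (algebraMap C T (φ s)) :=
          IsLocalization.map_units T (⟨φ s, h₁ s hs⟩ : nonZeroDivisors C)
        exact (hu.mul_left_cancel e').symm
      | algebraMap a => exact ⟨φ a, (hψ a).symm⟩
      | add x y _ _ hx hy =>
        rw [map_add]; exact add_mem hx hy
      | mul x y _ _ hx hy =>
        rw [map_mul]; exact mul_mem hx hy
    choose β hβ using hmem
    refine ⟨⟨⟨⟨β, ?_⟩, ?_⟩, ?_, ?_⟩, ?_⟩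
    · apply hinj; rw [hβ]; simp
    · intro x y; apply hinj; rw [hβ, map_mul, hβ, hβ]; simp
    · apply hinj; change algebraMap C T (β 0) = _; rw [hβ]; simp
    · intro x y; apply hinj; change algebraMap C T (β (x + y)) = algebraMap C T (β x + β y)
      rw [hβ, map_add, hβ, hβ]; simp
    · ext a; apply hinj
      change algebraMap C T (β (algebraMap A _ a)) = _
      rw [hβ]; exact hψ a
  · intro β β' hβ hβ'
    have hβ1 : ∀ a, β (algebraMap A _ a) = φ a := fun a => RingHom.congr_fun hβ a
    have hβ2 : ∀ a, β' (algebraMap A _ a) = φ a := fun a => RingHom.congr_fun hβ' a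
    ext ⟨b, hb⟩
    induction hb using Algebra.adjoin_induction with
    | mem b hb =>
      have hb' : b ∈ blowupAlgebra J S := Algebra.subset_adjoin hb
      obtain ⟨h, hh, s, hs, e⟩ := hb
      have e' : (⟨b, hb'⟩ : blowupAlgebra J S) * algebraMap A _ s = algebraMap A _ h :=
        Subtype.ext e
      have e1 := congrArg β e'
      have e2 := congrArg β' e'
      rw [map_mul, hβ1, hβ1] at e1
      rw [map_mul, hβ2, hβ2, ← e1] at e2
      exact ((mul_cancel_right_mem_nonZeroDivisors (h₁ s hs)).1 e2).symm
    | algebraMap a => exact (hβ1 a).trans (hβ2 a).symm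
    | add x y hx hy hx' hy' =>
      have : (⟨x + y, add_mem hx hy⟩ : blowupAlgebra J S) = ⟨x, hx⟩ + ⟨y, hy⟩ := rfl
      rw [this, map_add, map_add, hx', hy']
    | mul x y hx hy hx' hy' =>
      have : (⟨x * y, mul_mem hx hy⟩ : blowupAlgebra J S) = ⟨x, hx⟩ * ⟨y, hy⟩ := rfl
      rw [this, map_mul, map_mul, hx', hy']

end Algebra

section Sections

variable {X Z W : Scheme.{u}}

theorem germ_mem_nonZeroDivisors {V : Z.Opens} (hV : IsAffineOpen V) {a : Γ(Z, V)}
    (ha : a ∈ nonZeroDivisors Γ(Z, V)) {z : Z} (hz : z ∈ V) :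
    Z.presheaf.germ V z hz a ∈ nonZeroDivisors (Z.presheaf.stalk z) := by
  let := TopCat.Presheaf.algebra_section_stalk Z.presheaf ⟨z, hz⟩
  have := hV.isLocalization_stalk ⟨z, hz⟩
  exact IsLocalization.map_nonZeroDivisors_le (hV.primeIdealOf ⟨z, hz⟩).asIdeal.primeCompl _
     (Submonoid.mem_map_of_mem _ ha)

theorem mem_nonZeroDivisors_of_germ {V : Z.Opens} {a : Γ(Z, V)}
    (H : ∀ z (hz : z ∈ V), Z.presheaf.germ V z hz a ∈ nonZeroDivisors (Z.presheaf.stalk z)) :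
    a ∈ nonZeroDivisors Γ(Z, V) := by
  refine mem_nonZeroDivisors_iff_right.2 fun b hb => ?_
  refine TopCat.Presheaf.section_ext Z.sheaf V b 0 fun z hz => ?_
  have := congrArg (Z.presheaf.germ V z hz) hb
  rw [map_mul, map_zero] at this
  refine Eq.trans ?_ (map_zero (Z.presheaf.germ V z hz).hom).symm
  exact (mem_nonZeroDivisors_iff_right.1 (H z hz)) _ this

/-- Divisibility by a section whose germs are nonzerodivisors can be checked on germs. -/
theorem dvd_of_germ {V : Z.Opens} {a b : Γ(Z, V)}
    (H : ∀ z (hz : z ∈ V), Z.presheaf.germ V z hz a ∈ nonZeroDivisors (Z.presheaf.stalk z))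
    (H' : ∀ z (hz : z ∈ V), Z.presheaf.germ V z hz a ∣ Z.presheaf.germ V z hz b) : a ∣ b := by
  have key : ∀ z : V, ∃ (N : Z.Opens) (h : N ≤ V) (c : Γ(Z, N)), z.1 ∈ N ∧
      Z.presheaf.map (homOfLE h).op b = Z.presheaf.map (homOfLE h).op a * c := by
    rintro ⟨z, hz⟩
    obtain ⟨c, hc⟩ := H' z hz
    obtain ⟨N, hN, hzN, c, rfl⟩ := Z.presheaf.exists_le_germ_eq c hz
    obtain ⟨N', hz', i, j, hij⟩ := Z.presheaf.germ_eq z hz hzN b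
      (Z.presheaf.map (homOfLE hN).op a * c) (by
        rw [map_mul, Z.presheaf.germ_res_apply]; exact hc)
    refine ⟨N', i.le, Z.presheaf.map j.op c, hz', ?_⟩
    rw [map_mul, res_res] at hij
    exact hij
  -- the local quotients are unique, hence glue
  choose N hN c hzN hc using key
  have hcover : V ≤ iSup N := fun z hz =>
    TopologicalSpace.Opens.mem_iSup.2 ⟨⟨z, hz⟩, hzN ⟨z, hz⟩⟩
  have hcomp : TopCat.Presheaf.IsCompatible Z.sheaf.1 N c := by
    intro i j
    refine TopCat.Presheaf.section_ext Z.sheaf _ _ _ fun z hz => ?_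
    have hi := congrArg (Z.presheaf.germ (N i) z hz.1) (hc i)
    have hj := congrArg (Z.presheaf.germ (N j) z hz.2) (hc j)
    rw [map_mul, Z.presheaf.germ_res_apply, Z.presheaf.germ_res_apply] at hi hj
    have e := hi.symm.trans hj
    rw [mul_cancel_left_mem_nonZeroDivisors (H z (hN i hz.1))] at e
    refine (Z.presheaf.germ_res_apply _ _ _ _).trans (e.trans ?_)
    exact (Z.presheaf.germ_res_apply _ _ _ _).symm
  obtain ⟨d, hd, -⟩ := Z.sheaf.existsUnique_gluing' N V (fun i => homOfLE (hN i)) hcover c hcomp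
  refine ⟨d, TopCat.Presheaf.section_ext Z.sheaf V _ _ fun z hz => ?_⟩
  have h1 := congrArg (Z.presheaf.germ (N ⟨z, hz⟩) z (hzN ⟨z, hz⟩)) (hc ⟨z, hz⟩)
  have h2 := congrArg (Z.presheaf.germ (N ⟨z, hz⟩) z (hzN ⟨z, hz⟩)) (hd ⟨z, hz⟩)
  rw [map_mul, Z.presheaf.germ_res_apply, Z.presheaf.germ_res_apply] at h1
  refine h1.trans ?_
  refine Eq.trans ?_ (map_mul (Z.presheaf.germ V z hz).hom a d).symm
  congr 1
  exact h2.symm.trans (Z.presheaf.germ_res_apply _ _ _ _)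

end Sections

end BlowupConstruction

/-! ### Charts of the blow-up -/

namespace BlowupConstruction

variable {X Z W : Scheme.{u}}

theorem toSpecΓ_SpecMap_appLE_top (f : Z ⟶ X) {U : X.Opens} (hU : IsAffineOpen U)
    (h : (⊤ : Z.Opens) ≤ f ⁻¹ᵁ U) :
    Z.toSpecΓ ≫ Spec.map (f.appLE U ⊤ h) ≫ hU.fromSpec = f := by
  have h1 := congrArg (· ≫ hU.fromSpec) (Scheme.Opens.toSpecΓ_SpecMap_appLE f U ⊤ h)
  simp only [Category.assoc, hU.toSpecΓ_fromSpec, Scheme.Hom.resLE_comp_ι] at h1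
  rw [Scheme.Opens.toSpecΓ_top, Category.assoc] at h1
  have : IsIso (⊤ : Z.Opens).ι := Z.topIso.isIso_hom
  exact (cancel_epi (⊤ : Z.Opens).ι).1 h1

theorem SpecMap_fromSpec_appLE {U : X.Opens} (hU : IsAffineOpen U) {R : CommRingCat.{u}}
    (φ : Γ(X, U) ⟶ R) (h) :
    (Spec.map φ ≫ hU.fromSpec).appLE U ⊤ h = φ ≫ (Scheme.ΓSpecIso R).inv := by
  rw [← Scheme.Hom.appLE_comp_appLE _ _ U ⊤ ⊤ hU.fromSpec_preimage_self.ge le_rfl]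
  rw [Scheme.Hom.appLE, hU.fromSpec_app_self, Category.assoc, Category.assoc,
    ← Functor.map_comp_assoc]
  refine Eq.trans ?_ (Scheme.ΓSpecIso_inv_naturality φ).symm
  congr 1

/-- The germ of a pulled back section, for a morphism from an affine scheme. -/
theorem sectionGerm_SpecMap_fromSpec {U : X.Opens} (hU : IsAffineOpen U) {R : CommRingCat.{u}}
    (φ : Γ(X, U) ⟶ R) (y : Spec R) (hy : (Spec.map φ ≫ hU.fromSpec) y ∈ U) (a : Γ(X, U)) :
    sectionGerm (Spec.map φ ≫ hU.fromSpec) U y hy a =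
      (Spec R).presheaf.germ ⊤ y trivial ((Scheme.ΓSpecIso R).inv (φ a)) := by
  have h : (⊤ : (Spec R).Opens) ≤ (Spec.map φ ≫ hU.fromSpec) ⁻¹ᵁ U := by
    intro y _
    change hU.fromSpec (Spec.map φ y) ∈ U
    exact hU.range_fromSpec.le ⟨_, rfl⟩
  have h1 := congrArg (fun t : Γ(X, U) ⟶ Γ(Spec R, ⊤) =>
    (Spec R).presheaf.germ ⊤ y trivial (t.hom a)) (SpecMap_fromSpec_appLE hU φ h)
  refine Eq.trans ?_ h1
  exact ((Spec R).presheaf.germ_res_apply (homOfLE h) y trivial _).symm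

theorem germ_appLE (f : Z ⟶ X) {U : X.Opens} {V : Z.Opens} (h : V ≤ f ⁻¹ᵁ U) (z : Z) (hz : z ∈ V)
    (a : Γ(X, U)) :
    Z.presheaf.germ V z hz (f.appLE U V h a) = sectionGerm f U z (h hz) a :=
  Z.presheaf.germ_res_apply (homOfLE h) z hz _

theorem isAffineOpen_coe (U : X.affineOpens) : IsAffineOpen U.1 := U.2

variable {I : X.IdealSheafData}

theorem isGenAt_SpecMap_fromSpec {U : X.affineOpens} {R : CommRingCat.{u}} (φ : Γ(X, U) ⟶ R)
    {g : Γ(X, U)} (hg : φ g ∈ nonZeroDivisors R) (hd : ∀ h ∈ I.ideal U, φ g ∣ φ h)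
    (y : Spec R) : IsGenAt I (Spec.map φ ≫ (isAffineOpen_coe U).fromSpec) U g y := by
  have hy : (Spec.map φ ≫ (isAffineOpen_coe U).fromSpec) y ∈ U.1 := by
    change U.2.fromSpec (Spec.map φ y) ∈ U.1
    exact U.2.range_fromSpec.le ⟨_, rfl⟩
  let E : R ≃+* Γ(Spec R, ⊤) := (Scheme.ΓSpecIso R).symm.commRingCatIsoToRingEquiv
  refine ⟨hy, ?_, fun h hh => ?_⟩
  · rw [sectionGerm_SpecMap_fromSpec]
    refine germ_mem_nonZeroDivisors (isAffineOpen_top (Spec R)) ?_ _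
    change E (φ g) ∈ _
    rw [← MulEquivClass.map_nonZeroDivisors E]
    exact ⟨_, hg, rfl⟩
  · rw [sectionGerm_SpecMap_fromSpec, sectionGerm_SpecMap_fromSpec]
    exact map_dvd _ (map_dvd _ (hd h hh))

/-- An index of the charts of the blow-up: an affine open `U` and a finite nonempty set of
sections of the ideal over `U`, which are to become generators of the inverse image ideal. -/
structure Chart (I : X.IdealSheafData) where
  /-- the affine open over which the chart lies -/
  U : X.affineOpens
  /-- the sections that become generators -/
  S : Set Γ(X, U)
  finite : S.Finite
  nonempty : S.Nonempty
  subset : ∀ s ∈ S, s ∈ I.ideal U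

namespace Chart

/-- The coordinate ring of a chart. -/
def ring (c : Chart I) : CommRingCat.{u} := .of (blowupAlgebra (I.ideal c.U) c.S)

/-- The structure map of the coordinate ring. -/
def structureMap (c : Chart I) : Γ(X, c.U) ⟶ c.ring := CommRingCat.ofHom (algebraMap _ _)

/-- The projection of a chart to `X`. -/
def proj (c : Chart I) : Spec c.ring ⟶ X :=
  Spec.map c.structureMap ≫ (isAffineOpen_coe c.U).fromSpec

/-- A morphism to `X` over which all the sections of the chart generate the inverse image ideal
and are nonzerodivisors; these are the morphisms that factor through the chart. -/
def Good (c : Chart I) (f : Z ⟶ X) : Prop := ∀ z, ∀ s ∈ c.S, IsGenAt I f c.U s z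

theorem good_proj (c : Chart I) : c.Good c.proj := fun y _ hs =>
  isGenAt_SpecMap_fromSpec c.structureMap (blowupAlgebra_mem_nonZeroDivisors hs)
    (fun _ hh => by
      obtain ⟨b, hb⟩ := blowupAlgebra_exists_mul_eq hs hh
      exact ⟨b, hb.symm.trans (mul_comm _ _)⟩) y

theorem Good.comp {c : Chart I} {f : Z ⟶ X} (H : c.Good f) (e : W ⟶ Z) [IsOpenImmersion e] :
    c.Good (e ≫ f) := fun w s hs => (isGenAt_comp_iff e f c.U s w).2 (H (e w) s hs)

theorem Good.le_preimage {c : Chart I} {f : Z ⟶ X} (H : c.Good f) :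
    (⊤ : Z.Opens) ≤ f ⁻¹ᵁ c.U.1 := fun z _ =>
  (H z _ c.nonempty.some_mem).choose

theorem Good.mem_nonZeroDivisors {c : Chart I} {f : Z ⟶ X} (H : c.Good f) {s : Γ(X, c.U)}
    (hs : s ∈ c.S) : f.appLE c.U ⊤ H.le_preimage s ∈ nonZeroDivisors Γ(Z, ⊤) :=
  mem_nonZeroDivisors_of_germ fun z _ => by
    rw [germ_appLE f H.le_preimage z trivial]
    exact (H z s hs).choose_spec.1

theorem Good.dvd {c : Chart I} {f : Z ⟶ X} (H : c.Good f) {s h : Γ(X, c.U)}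
    (hs : s ∈ c.S) (hh : h ∈ I.ideal c.U) :
    f.appLE c.U ⊤ H.le_preimage s ∣ f.appLE c.U ⊤ H.le_preimage h :=
  dvd_of_germ
    (fun z _ => by
      rw [germ_appLE f H.le_preimage z trivial]
      exact (H z s hs).choose_spec.1)
    (fun z _ => by
      rw [germ_appLE f H.le_preimage z trivial,
        germ_appLE f H.le_preimage z trivial]
      exact (H z s hs).choose_spec.2 h hh)

/-- Good morphisms factor uniquely through the chart. -/
theorem Good.existsUnique_lift {c : Chart I} {f : Z ⟶ X} (H : c.Good f) :
    ∃! h : Z ⟶ Spec c.ring, h ≫ c.proj = f := by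
  obtain ⟨β, hβ, hu⟩ := existsUnique_blowupAlgebra_lift (J := I.ideal c.U) (S := c.S)
    (f.appLE c.U ⊤ H.le_preimage).hom (fun s hs => H.mem_nonZeroDivisors hs)
    (fun s hs h hh => H.dvd hs hh)
  let β' : c.ring ⟶ Γ(Z, ⊤) := CommRingCat.ofHom β
  have hβ' : c.structureMap ≫ β' = f.appLE c.U ⊤ H.le_preimage := CommRingCat.hom_ext hβ
  refine ⟨Z.toSpecΓ ≫ Spec.map β', ?_, ?_⟩
  · change (Z.toSpecΓ ≫ Spec.map β') ≫ c.proj = f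
    rw [proj, Category.assoc, ← Spec.map_comp_assoc, hβ', toSpecΓ_SpecMap_appLE_top]
  · intro h hh
    have h1 : h = Z.toSpecΓ ≫ Spec.map ((Scheme.ΓSpecIso c.ring).inv ≫ h.appTop) := by
      rw [Spec.map_comp, ← Scheme.toSpecΓ_naturality_assoc, toSpecΓ_SpecMap_ΓSpecIso_inv,
        Category.comp_id]
    have h2 : c.structureMap ≫ (Scheme.ΓSpecIso c.ring).inv ≫ h.appTop =
        f.appLE c.U ⊤ H.le_preimage := by
      have hle : (⊤ : (Spec c.ring).Opens) ≤ c.proj ⁻¹ᵁ c.U.1 := c.good_proj.le_preimage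
      rw [← Category.assoc, ← SpecMap_fromSpec_appLE (isAffineOpen_coe c.U) c.structureMap hle]
      subst hh
      rw [Scheme.Hom.appTop, Scheme.Hom.app_eq_appLE]
      exact Scheme.Hom.appLE_comp_appLE _ _ _ _ _ _ _
    have h3 : (Scheme.ΓSpecIso c.ring).inv ≫ h.appTop = β' :=
      CommRingCat.hom_ext (hu _ (congrArg CommRingCat.Hom.hom h2))
    rw [h1, h3]

/-- The factorization of a good morphism through the chart. -/
def Good.lift {c : Chart I} {f : Z ⟶ X} (H : c.Good f) : Z ⟶ Spec c.ring :=
  H.existsUnique_lift.choose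

theorem Good.lift_proj {c : Chart I} {f : Z ⟶ X} (H : c.Good f) : H.lift ≫ c.proj = f :=
  H.existsUnique_lift.choose_spec.1

theorem Good.hom_ext {c : Chart I} {f : Z ⟶ X} (H : c.Good f) {h h' : Z ⟶ Spec c.ring}
    (e : h ≫ c.proj = f) (e' : h' ≫ c.proj = f) : h = h' :=
  H.existsUnique_lift.unique e e'

/-- `c ≤ d` if `c` lies over a smaller affine open and inverts at least the sections of `d`. -/
instance : Preorder (Chart I) where
  le c d := ∃ h : c.U.1 ≤ d.U.1, ∀ s ∈ d.S, X.presheaf.map (homOfLE h).op s ∈ c.S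
  le_refl c := ⟨le_rfl, fun s hs => by
    have : X.presheaf.map (homOfLE (le_refl c.U.1)).op = 𝟙 _ := X.presheaf.map_id _
    rw [this]
    exact hs⟩
  le_trans c d e := by
    rintro ⟨h₁, H₁⟩ ⟨h₂, H₂⟩
    refine ⟨h₁.trans h₂, fun s hs => ?_⟩
    have := H₁ _ (H₂ s hs)
    rwa [res_res] at this

theorem Good.mono {c d : Chart I} (hcd : c ≤ d) {f : Z ⟶ X} (H : c.Good f) : d.Good f :=
  fun z s hs => (H z _ (hcd.2 s hs)).of_res hcd.1

/-- Two charts over which a morphism factors have a common refinement near each point. -/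
theorem Good.exists_refinement {c d : Chart I} {f : Z ⟶ X} (Hc : c.Good f) (Hd : d.Good f)
    (z : Z) : ∃ e : Chart I, e ≤ c ∧ e ≤ d ∧ ∃ N : Z.Opens, z ∈ N ∧ e.Good (N.ι ≫ f) := by
  obtain ⟨T, hzT, hTc, hTd⟩ := exists_affine_le_inf
    (show f z ∈ c.U.1 from Hc.le_preimage (x := z) trivial)
    (show f z ∈ d.U.1 from Hd.le_preimage (x := z) trivial)
  let rc := X.presheaf.map (homOfLE hTc).op
  let rd := X.presheaf.map (homOfLE hTd).op
  refine ⟨⟨T, rc '' c.S ∪ rd '' d.S, (c.finite.image _).union (d.finite.image _),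
    (c.nonempty.image _).inl, ?_⟩, ⟨hTc, fun s hs => Or.inl ⟨s, hs, rfl⟩⟩,
    ⟨hTd, fun s hs => Or.inr ⟨s, hs, rfl⟩⟩, f ⁻¹ᵁ T.1, hzT, ?_⟩
  · rintro _ (⟨s, hs, rfl⟩ | ⟨s, hs, rfl⟩)
    · rw [← I.map_ideal' (homOfLE hTc).op]
      exact Ideal.mem_map_of_mem _ (c.subset s hs)
    · rw [← I.map_ideal' (homOfLE hTd).op]
      exact Ideal.mem_map_of_mem _ (d.subset s hs)
  · rintro w _ (⟨s, hs, rfl⟩ | ⟨s, hs, rfl⟩)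
    · rw [isGenAt_comp_iff]
      exact (Hc _ s hs).res hTc w.2
    · rw [isGenAt_comp_iff]
      exact (Hd _ s hs).res hTd w.2

/-- The transition morphism between charts. -/
def map {c d : Chart I} (h : c ≤ d) : Spec c.ring ⟶ Spec d.ring := (c.good_proj.mono h).lift

theorem map_proj {c d : Chart I} (h : c ≤ d) : map h ≫ d.proj = c.proj :=
  (c.good_proj.mono h).lift_proj

/-- The transition morphisms are open immersions: by the universal property, `Spec c.ring` is the
open subscheme of `Spec d.ring` over which the sections of `c` are generators. -/
instance isOpenImmersion_map {c d : Chart I} (h : c ≤ d) : IsOpenImmersion (map h) := by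
  obtain ⟨s, hs⟩ := d.nonempty
  let O : Set (Spec d.ring) := {y | ∀ t ∈ c.S, IsGenAt I d.proj c.U t y}
  have hO : IsOpen O := by
    have : O = ⋂ t ∈ c.S, {y | IsGenAt I d.proj c.U t y} := by
      ext y; simp [O]
    rw [this]
    refine c.finite.isOpen_biInter fun t ht => isOpen_iff_forall_mem_open.2 fun y hy => ?_
    obtain ⟨N, hyN, hN⟩ := IsGenAt.eventually (d.subset s hs) (c.subset t ht)
      (fun z => d.good_proj z s hs) hy
    exact ⟨N, hN, N.2, hyN⟩
  let N : (Spec d.ring).Opens := ⟨O, hO⟩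
  have hN : c.Good (N.ι ≫ d.proj) := fun w t ht =>
    (isGenAt_comp_iff N.ι d.proj c.U t w).2 (w.2 t ht)
  have hrange : Set.range (map h) ⊆ Set.range N.ι := by
    rw [Scheme.Opens.range_ι]
    rintro _ ⟨y, rfl⟩ t ht
    refine IsGenAt.of_comp (d.subset s hs) (c.subset t ht) (d.good_proj _ s hs) ?_ ?_
    · rw [map_proj]; exact c.good_proj y t ht
    · rw [map_proj]; exact (c.good_proj.mono h) y s hs
  let l : Spec c.ring ⟶ N.toScheme := IsOpenImmersion.lift N.ι (map h) hrange
  have hl : l ≫ N.ι = map h := IsOpenImmersion.lift_fac _ _ _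
  have h1 : l ≫ hN.lift = 𝟙 _ := by
    refine c.good_proj.hom_ext ?_ (Category.id_comp _)
    rw [Category.assoc, hN.lift_proj, ← Category.assoc, hl, map_proj]
  have h2 : hN.lift ≫ l = 𝟙 _ := by
    rw [← cancel_mono N.ι, Category.assoc, hl, Category.id_comp]
    refine (d.good_proj.comp N.ι).hom_ext ?_ rfl
    rw [Category.assoc, map_proj, hN.lift_proj]
  have : IsIso l := ⟨hN.lift, h1, h2⟩
  rw [← hl]
  infer_instance

end Chart

/-- The diagram of charts. -/
def chartFunctor (I : X.IdealSheafData) : Chart I ⥤ Scheme.{u} where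
  obj c := Spec c.ring
  map h := Chart.map (leOfHom h)
  map_id c := c.good_proj.hom_ext (Chart.map_proj _) (Category.id_comp _)
  map_comp {c d e} h h' := ((c.good_proj.mono (leOfHom h)).mono (leOfHom h')).hom_ext
    (Chart.map_proj (leOfHom (h ≫ h')))
    (by rw [Category.assoc, Chart.map_proj, Chart.map_proj])

instance {c d : Chart I} (h : c ⟶ d) : IsOpenImmersion ((chartFunctor I).map h) :=
  Chart.isOpenImmersion_map (leOfHom h)

theorem chartFunctor_map_proj {c d : Chart I} (h : c ⟶ d) :
    (chartFunctor I).map h ≫ d.proj = c.proj := Chart.map_proj (leOfHom h)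

end BlowupConstruction

/-! ### Invertible inverse image ideals -/

namespace BlowupConstruction

variable {X Z W : Scheme.{u}} {I : X.IdealSheafData}

/-- A morphism from an affine scheme to `U` that kills the sections of `I` over `U` factors through
the closed subscheme of `I`. -/
theorem le_ker_SpecMap_fromSpec {U : X.affineOpens} {R : CommRingCat.{u}} (φ : Γ(X, U) ⟶ R)
    (hφ : ∀ h ∈ I.ideal U, φ h = 0) :
    I ≤ (Spec.map φ ≫ (isAffineOpen_coe U).fromSpec).ker := by
  rw [Scheme.Hom.ker, Scheme.IdealSheafData.le_ofIdeals_iff]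
  intro V h hh
  rw [RingHom.mem_ker]
  refine TopCat.Presheaf.section_ext (Spec R).sheaf _ _ _ fun y hy => ?_
  refine Eq.trans ?_ (map_zero ((Spec R).presheaf.germ _ y hy).hom).symm
  have hyU : (Spec.map φ ≫ (isAffineOpen_coe U).fromSpec) y ∈ U.1 := by
    change (isAffineOpen_coe U).fromSpec (Spec.map φ y) ∈ U.1
    exact (isAffineOpen_coe U).range_fromSpec.le ⟨_, rfl⟩
  have h1 := sectionGerm_mem_map I _ hyU hy hh
  have h2 : (I.ideal U).map (sectionGerm (Spec.map φ ≫ (isAffineOpen_coe U).fromSpec) U y hyU)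
      ≤ ⊥ := by
    rw [Ideal.map_le_iff_le_comap]
    intro a ha
    rw [Ideal.mem_comap, Ideal.mem_bot, sectionGerm_SpecMap_fromSpec, hφ a ha, map_zero, map_zero]
  exact Ideal.mem_bot.1 (h2 h1)

/-- The inverse image of an ideal sheaf on affine opens. -/
theorem comap_ideal (f : Z ⟶ X) (U : X.affineOpens) (V : Z.affineOpens) (e : V.1 ≤ f ⁻¹ᵁ U.1) :
    (I.comap f).ideal V = (I.ideal U).map (f.appLE U V e).hom := by
  apply le_antisymm
  -- the closed subscheme of `V` cut out by the pulled back sections maps to that of `I`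
  · let M := (I.ideal U).map (f.appLE U V e).hom
    let q : Γ(Z, V) ⟶ CommRingCat.of (Γ(Z, V) ⧸ M) := CommRingCat.ofHom (Ideal.Quotient.mk M)
    let t := Spec.map q ≫ (isAffineOpen_coe V).fromSpec
    have h1 : I.comap f ≤ t.ker := by
      rw [← Scheme.IdealSheafData.le_map_iff_comap_le, Scheme.IdealSheafData.map_ker]
      have : t ≫ f = Spec.map (f.appLE U V e ≫ q) ≫ (isAffineOpen_coe U).fromSpec := by
        rw [Spec.map_comp, Category.assoc, Category.assoc,
          IsAffineOpen.SpecMap_appLE_fromSpec f _ (isAffineOpen_coe V)]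
      rw [this]
      refine le_ker_SpecMap_fromSpec _ fun h hh => ?_
      exact Ideal.Quotient.eq_zero_iff_mem.2 (Ideal.mem_map_of_mem _ hh)
    intro a ha
    have h2 : t.app V a = 0 := t.ideal_ker_le V (h1 V ha)
    have hle : (⊤ : (Spec (CommRingCat.of (Γ(Z, V) ⧸ M))).Opens) ≤ t ⁻¹ᵁ V.1 := by
      intro y _
      change (isAffineOpen_coe V).fromSpec (Spec.map q y) ∈ V.1
      exact (isAffineOpen_coe V).range_fromSpec.le ⟨_, rfl⟩
    have h3 : t.appLE V ⊤ hle a = 0 := by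
      change (Spec (CommRingCat.of (Γ(Z, V) ⧸ M))).presheaf.map (homOfLE hle).op (t.app V a) = 0
      rw [h2, map_zero]
    rw [SpecMap_fromSpec_appLE] at h3
    have h4 : q a = 0 :=
      (map_eq_zero_iff _ (Scheme.ΓSpecIso _).symm.commRingCatIsoToRingEquiv.injective).1 h3
    exact Ideal.Quotient.eq_zero_iff_mem.1 h4
  · rw [Ideal.map_le_iff_le_comap]
    intro a ha
    have h1 := Scheme.Hom.ideal_ker_le _ U (Scheme.IdealSheafData.le_map_comap I f U ha)
    rw [Ideal.mem_comap]
    rw [← (I.comap f).ker_subschemeι, Scheme.Hom.ker_apply, RingHom.mem_ker]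
    rw [RingHom.mem_ker] at h1
    have h2 := congrArg ((I.comap f).subscheme.presheaf.map
      (homOfLE (show (I.comap f).subschemeι ⁻¹ᵁ V.1 ≤
        ((I.comap f).subschemeι ≫ f) ⁻¹ᵁ U.1 from fun y hy => e hy)).op) h1
    rw [map_zero] at h2
    refine Eq.trans ?_ h2
    rw [Scheme.Hom.comp_app]
    have := (I.comap f).subschemeι.naturality (homOfLE e).op
    exact congrArg (fun t : Γ(Z, f ⁻¹ᵁ U.1) ⟶ _ => t.hom (f.app U a)) this

/-- If the inverse image ideal is invertible, then locally one of the sections of `I` generates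
it. -/
theorem exists_good_of_isInvertible {g : Z ⟶ X} (H : IsInvertibleIdealSheaf (I.comap g)) (z : Z) :
    ∃ (c : Chart I) (N : Z.Opens), z ∈ N ∧ c.Good (N.ι ≫ g) := by
  obtain ⟨V₀, hzV₀, a₀, ha₀, hV₀⟩ := H z
  obtain ⟨U, hzU, -⟩ := exists_affine_le_inf (X := X) (x := g z) (U := ⊤) (V := ⊤) trivial trivial
  obtain ⟨V, hzV, hVV₀, hVU⟩ := exists_affine_le_inf hzV₀ (show z ∈ g ⁻¹ᵁ U.1 from hzU)
  let a : Γ(Z, V) := Z.presheaf.map (homOfLE hVV₀).op a₀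
  have ha : ∀ y (hy : y ∈ V.1), Z.presheaf.germ V y hy a ∈ nonZeroDivisors _ := fun y hy => by
    rw [Z.presheaf.germ_res_apply]
    exact germ_mem_nonZeroDivisors V₀.2 ha₀ _
  have hV : (I.comap g).ideal V = Ideal.span {a} := by
    rw [← (I.comap g).map_ideal' (homOfLE hVV₀).op, hV₀, Ideal.map_span, Set.image_singleton]
  rw [comap_ideal g U V hVU] at hV
  have hdvd : ∀ h ∈ I.ideal U, a ∣ g.appLE U V hVU h := fun h hh => by
    rw [← Ideal.mem_span_singleton, ← hV]
    exact Ideal.mem_map_of_mem _ hh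
  -- as `a` is cancellable, one of the sections of `I` is the generator `a` times a unit at `z`
  obtain ⟨s, hs, d, hd, hdz⟩ : ∃ s ∈ I.ideal U, ∃ d, g.appLE U V hVU s = a * d ∧
      IsUnit (Z.presheaf.germ V z hzV d) := by
    by_contra! hcon
    have h1 : (I.ideal U).map ((g.appLE U V hVU).hom) ≤
        (IsLocalRing.maximalIdeal (Z.presheaf.stalk z) *
          Ideal.span {Z.presheaf.germ V z hzV a}).comap (Z.presheaf.germ V z hzV).hom := by
      rw [Ideal.map_le_iff_le_comap]
      intro h hh
      obtain ⟨d, hd⟩ := hdvd h hh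
      rw [Ideal.mem_comap, Ideal.mem_comap]
      have : (g.appLE U V hVU).hom h = d * a := hd.trans (mul_comm _ _)
      rw [this, map_mul]
      exact Ideal.mul_mem_mul ((IsLocalRing.mem_maximalIdeal _).2 (hcon h hh d hd))
        (Ideal.mem_span_singleton_self _)
    have h2 : a ∈ (I.ideal U).map ((g.appLE U V hVU).hom) := by
      rw [hV]; exact Ideal.mem_span_singleton_self _
    obtain ⟨m, hm, hma⟩ := Ideal.mem_mul_span_singleton.1 (h1 h2)
    have h3 : m = 1 := by
      rw [← mul_cancel_right_mem_nonZeroDivisors (ha z hzV), one_mul]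
      exact hma
    rw [h3] at hm
    exact (IsLocalRing.maximalIdeal.isMaximal _).ne_top ((Ideal.eq_top_iff_one _).2 hm)
  refine ⟨⟨U, {s}, Set.finite_singleton s, Set.singleton_nonempty s, by rintro _ rfl; exact hs⟩,
    Z.basicOpen d, (Z.mem_basicOpen d z hzV).2 hdz, ?_⟩
  suffices key : ∀ y ∈ Z.basicOpen d, IsGenAt I g U s y by
    intro w t ht
    rw [Set.mem_singleton_iff.1 ht, isGenAt_comp_iff]
    exact key _ w.2
  intro y hw
  have hyV : y ∈ V.1 := Z.basicOpen_le d hw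
  have hu : IsUnit (Z.presheaf.germ V y hyV d) := (Z.mem_basicOpen d y hyV).1 hw
  have hg : sectionGerm g U y (hVU hyV) s =
      Z.presheaf.germ V y hyV a * Z.presheaf.germ V y hyV d := by
    rw [← germ_appLE g hVU y hyV, hd, map_mul]
  refine ⟨hVU hyV, ?_, fun h hh => ?_⟩
  · rw [hg]
    exact mul_mem (ha y hyV) hu.mem_nonZeroDivisors
  · rw [hg, hu.mul_right_dvd, ← germ_appLE g hVU y hyV]
    exact map_dvd _ (hdvd h hh)

/-- Conversely, the inverse image ideal is invertible if it is generated locally by sections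
of `I` that are nonzerodivisors. -/
theorem isInvertible_of_isGenAt {f : Z ⟶ X}
    (H : ∀ z, ∃ (c : Chart I) (N : Z.Opens), z ∈ N ∧ c.Good (N.ι ≫ f)) :
    IsInvertibleIdealSheaf (I.comap f) := by
  intro z
  obtain ⟨c, N, hzN, hc⟩ := H z
  obtain ⟨s, hs⟩ := c.nonempty
  have hgen : ∀ y ∈ N, IsGenAt I f c.U s y := fun y hy =>
    (isGenAt_comp_iff N.ι f c.U s ⟨y, hy⟩).1 (hc ⟨y, hy⟩ s hs)
  obtain ⟨V, hzV, hVN, -⟩ := exists_affine_le_inf hzN hzN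
  have hle : V.1 ≤ f ⁻¹ᵁ c.U.1 := fun y hy => (hgen y (hVN hy)).choose
  have hnzd : ∀ y (hy : y ∈ V.1), Z.presheaf.germ V y hy (f.appLE c.U V hle s) ∈
      nonZeroDivisors (Z.presheaf.stalk y) := fun y hy => by
    rw [germ_appLE]
    exact (hgen y (hVN hy)).choose_spec.1
  refine ⟨V, hzV, f.appLE c.U V hle s, mem_nonZeroDivisors_of_germ hnzd, ?_⟩
  rw [comap_ideal f c.U V hle]
  apply le_antisymm
  · rw [Ideal.map_le_iff_le_comap]
    intro h hh
    rw [Ideal.mem_comap, Ideal.mem_span_singleton]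
    refine dvd_of_germ hnzd fun y hy => ?_
    rw [germ_appLE]
    refine ((hgen y (hVN hy)).choose_spec.2 h hh).trans (dvd_of_eq ?_)
    exact (germ_appLE f hle y hy h).symm
  · rw [Ideal.span_singleton_le_iff_mem]
    exact Ideal.mem_map_of_mem _ (c.subset s hs)

end BlowupConstruction

/-! ### The blow-up of an ideal sheaf -/

namespace BlowupConstruction

variable {X Z W : Scheme.{u}} {I : X.IdealSheafData}

theorem Chart.good_ι_comp_iff {c : Chart I} {f : Z ⟶ X} {N : Z.Opens} :
    c.Good (N.ι ≫ f) ↔ ∀ y ∈ N, ∀ s ∈ c.S, IsGenAt I f c.U s y :=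
  ⟨fun H y hy s hs => (isGenAt_comp_iff N.ι f c.U s ⟨y, hy⟩).1 (H ⟨y, hy⟩ s hs),
    fun H y s hs => (isGenAt_comp_iff N.ι f c.U s y).2 (H _ y.2 s hs)⟩

/-- Two charts contained in a third one meet in a union of charts. -/
theorem Chart.exists_of_map_eq {c d e : Chart I} (hc : c ≤ e) (hd : d ≤ e) {yc : Spec c.ring}
    {yd : Spec d.ring} (h : Chart.map hc yc = Chart.map hd yd) :
    ∃ (a : Chart I) (hac : a ≤ c) (had : a ≤ d) (x : Spec a.ring),
      Chart.map hac x = yc ∧ Chart.map had x = yd := by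
  have good : ∀ {a : Chart I} (ha : a ≤ e), ∀ y ∈ (Chart.map ha).opensRange, ∀ s ∈ a.S,
      IsGenAt I e.proj a.U s y := by
    rintro a ha _ ⟨y, rfl⟩ s hs
    rw [← isGenAt_comp_iff, Chart.map_proj]
    exact a.good_proj y s hs
  let N : (Spec e.ring).Opens := (Chart.map hc).opensRange ⊓ (Chart.map hd).opensRange
  have hc' : c.Good (N.ι ≫ e.proj) := Chart.good_ι_comp_iff.2 fun y hy => good hc y hy.1
  have hd' : d.Good (N.ι ≫ e.proj) := Chart.good_ι_comp_iff.2 fun y hy => good hd y hy.2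
  have hyc : Chart.map hc yc ∈ N := ⟨⟨yc, rfl⟩, ⟨yd, h.symm⟩⟩
  obtain ⟨a, hac, had, N', hN', ha⟩ := hc'.exists_refinement hd' ⟨_, hyc⟩
  let z' : N' := ⟨_, hN'⟩
  have hlift : ∀ {b : Chart I} (hab : a ≤ b) (hb : b ≤ e),
      ha.lift ≫ Chart.map hab ≫ Chart.map hb = N'.ι ≫ N.ι := fun {b} hab hb => by
    refine ((e.good_proj.comp N.ι).comp N'.ι).hom_ext ?_ (Category.assoc _ _ _)
    rw [Category.assoc, Category.assoc, Chart.map_proj, Chart.map_proj, ha.lift_proj]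
  refine ⟨a, hac, had, ha.lift z', ?_, ?_⟩
  · apply (Chart.map hc).isOpenEmbedding.injective
    exact congrArg (fun t : N'.toScheme ⟶ Spec e.ring => t z') (hlift hac hc)
  · apply (Chart.map hd).isOpenEmbedding.injective
    exact (congrArg (fun t : N'.toScheme ⟶ Spec e.ring => t z') (hlift had hd)).trans h

instance isLocallyDirected_chartFunctor (I : X.IdealSheafData) :
    (chartFunctor I ⋙ Scheme.forget).IsLocallyDirected :=
  ⟨fun fc fd _ _ h => by
    obtain ⟨a, hac, had, x, hx, hx'⟩ := Chart.exists_of_map_eq (leOfHom fc) (leOfHom fd) h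
    exact ⟨a, homOfLE hac, homOfLE had, x, hx, hx'⟩⟩

/-- The blow-up of `X` along `I`, glued from the charts. -/
def blowup (I : X.IdealSheafData) : Scheme.{u} := Limits.colimit (chartFunctor I)

/-- The inclusion of a chart. -/
def chartι (c : Chart I) : Spec c.ring ⟶ blowup I := Limits.colimit.ι (chartFunctor I) c

instance (c : Chart I) : IsOpenImmersion (chartι c) :=
  inferInstanceAs (IsOpenImmersion (Limits.colimit.ι (chartFunctor I) c))

theorem map_chartι {c d : Chart I} (h : c ≤ d) : Chart.map h ≫ chartι d = chartι c :=
  Limits.colimit.w (chartFunctor I) (homOfLE h)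

/-- The projection of the blow-up to `X`. -/
def blowupProj (I : X.IdealSheafData) : blowup I ⟶ X :=
  Limits.colimit.desc (chartFunctor I)
    ⟨X, { app := fun c => c.proj
          naturality := fun _ _ h => (chartFunctor_map_proj h).trans (Category.comp_id _).symm }⟩

theorem chartι_blowupProj (c : Chart I) : chartι c ≫ blowupProj I = c.proj :=
  Limits.colimit.ι_desc _ _

theorem exists_chartι_eq (y : blowup I) : ∃ (c : Chart I) (y' : Spec c.ring), chartι c y' = y :=
  Scheme.IsLocallyDirected.ι_jointly_surjective (chartFunctor I) y

/-- Near each point of the source, a morphism to the blow-up factors through a chart. -/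
theorem exists_factor_chart (h : Z ⟶ blowup I) (z : Z) :
    ∃ (c : Chart I) (N : Z.Opens) (l : N.toScheme ⟶ Spec c.ring), z ∈ N ∧
      l ≫ chartι c = N.ι ≫ h := by
  obtain ⟨c, y, hy⟩ := exists_chartι_eq (h z)
  refine ⟨c, h ⁻¹ᵁ (chartι c).opensRange, IsOpenImmersion.lift (chartι c) (Scheme.Opens.ι _ ≫ h) ?_,
    ⟨y, hy⟩, IsOpenImmersion.lift_fac _ _ _⟩
  rintro _ ⟨w, rfl⟩
  exact w.2

theorem isInvertible_comap_blowupProj (I : X.IdealSheafData) :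
    IsInvertibleIdealSheaf (I.comap (blowupProj I)) := by
  refine isInvertible_of_isGenAt fun y => ?_
  obtain ⟨c, y', hy⟩ := exists_chartι_eq y
  refine ⟨c, (chartι c).opensRange, ⟨y', hy⟩, ?_⟩
  have := c.good_proj.comp (chartι c).isoOpensRange.inv
  rwa [← chartι_blowupProj c, ← Category.assoc, Scheme.Hom.isoOpensRange_inv_comp] at this

/-- A generator of the inverse image ideal stays a generator after pulling back further, provided
that the pulled back ideal is still generated by a nonzerodivisor. -/
theorem IsGenAt.comp {e : W ⟶ Z} {f : Z ⟶ X} {U V : X.affineOpens} {s : Γ(X, U)}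
    {t : Γ(X, V)} (ht : t ∈ I.ideal V) {w : W} (H : IsGenAt I f U s (e w))
    (H' : IsGenAt I (e ≫ f) V t w) : IsGenAt I (e ≫ f) U s w := by
  obtain ⟨hU, -, hd⟩ := H
  have hU' : (e ≫ f) w ∈ U.1 := hU
  have hd' : ∀ h ∈ I.ideal U, sectionGerm (e ≫ f) U w hU' s ∣ sectionGerm (e ≫ f) U w hU' h :=
    fun h hh => by
      rw [sectionGerm_comp e f _ w hU' hU, sectionGerm_comp e f _ w hU' hU]
      exact map_dvd _ (hd h hh)
  refine ⟨hU', ?_, hd'⟩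
  obtain ⟨hV, hnzd, -⟩ := H'
  have h1 : (I.ideal U).map (sectionGerm (e ≫ f) U w hU') ≤
      Ideal.span {sectionGerm (e ≫ f) U w hU' s} := by
    rw [Ideal.map_le_iff_le_comap]
    intro h hh
    rw [Ideal.mem_comap, Ideal.mem_span_singleton]
    exact hd' h hh
  obtain ⟨c, hc⟩ := Ideal.mem_span_singleton.1 (h1 (sectionGerm_mem_map I _ hU' hV ht))
  rw [hc] at hnzd
  exact (mul_mem_nonZeroDivisors.1 hnzd).1

/-- Morphisms to the blow-up are determined by their composition with the projection. -/
theorem blowup_hom_ext {g : Z ⟶ X}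
    (Hg : ∀ z, ∃ (U : X.affineOpens) (t : Γ(X, U)), t ∈ I.ideal U ∧ IsGenAt I g U t z)
    {h h' : Z ⟶ blowup I} (e : h ≫ blowupProj I = g) (e' : h' ≫ blowupProj I = g) : h = h' := by
  have good : ∀ {k : Z ⟶ blowup I} (_ : k ≫ blowupProj I = g) {c : Chart I} {N : Z.Opens}
      {l : N.toScheme ⟶ Spec c.ring} (_ : l ≫ chartι c = N.ι ≫ k),
      l ≫ c.proj = N.ι ≫ g ∧ ∀ y ∈ N, ∀ s ∈ c.S, IsGenAt I g c.U s y := by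
    intro k hk c N l hl
    have hp : l ≫ c.proj = N.ι ≫ g := by
      rw [← chartι_blowupProj, ← Category.assoc, hl, Category.assoc, hk]
    refine ⟨hp, Chart.good_ι_comp_iff.1 fun y s hs => ?_⟩
    obtain ⟨U, t, ht, H⟩ := Hg (N.ι y)
    have H' := (isGenAt_comp_iff N.ι g U t y).2 H
    rw [← hp] at H' ⊢
    exact (c.good_proj (l y) s hs).comp ht H'
  refine Scheme.hom_ext_of_forall h h' fun z => ?_
  obtain ⟨c, N, l, hzN, hl⟩ := exists_factor_chart h z
  obtain ⟨c', N', l', hzN', hl'⟩ := exists_factor_chart h' z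
  obtain ⟨hp, hg⟩ := good e hl
  obtain ⟨hp', hg'⟩ := good e' hl'
  let O : Z.Opens := N ⊓ N'
  have hc : c.Good (O.ι ≫ g) := Chart.good_ι_comp_iff.2 fun y hy => hg y hy.1
  have hc' : c'.Good (O.ι ≫ g) := Chart.good_ι_comp_iff.2 fun y hy => hg' y hy.2
  obtain ⟨a, hac, hac', M, hzM, ha⟩ := hc.exists_refinement hc' ⟨z, hzN, hzN'⟩
  -- on a small neighbourhood both morphisms factor through the common refinement `a`
  have key : ∀ {b : Chart I} (hab : a ≤ b) (hb : b.Good (O.ι ≫ g)) {N₁ : Z.Opens} (hO : O ≤ N₁)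
      {l₁ : N₁.toScheme ⟶ Spec b.ring} {k : Z ⟶ blowup I} (_ : l₁ ≫ chartι b = N₁.ι ≫ k)
      (_ : l₁ ≫ b.proj = N₁.ι ≫ g), ha.lift ≫ chartι a = M.ι ≫ O.ι ≫ k := by
    intro b hab hb N₁ hO l₁ k hk hp
    have h1 : ha.lift ≫ Chart.map hab = M.ι ≫ Z.homOfLE hO ≫ l₁ := by
      refine (hb.comp M.ι).hom_ext ?_ ?_
      · rw [Category.assoc, Chart.map_proj, ha.lift_proj]
      · rw [Category.assoc, Category.assoc, hp, Scheme.homOfLE_ι_assoc]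
    rw [← map_chartι hab, ← Category.assoc, h1, Category.assoc, Category.assoc, hk,
      Scheme.homOfLE_ι_assoc]
  have h1 := key hac hc inf_le_left hl hp
  have h2 := key hac' hc' inf_le_right hl' hp'
  refine ⟨(M.ι ≫ O.ι).opensRange, ⟨⟨⟨z, hzN, hzN'⟩, hzM⟩, rfl⟩, ?_⟩
  rw [← cancel_epi (M.ι ≫ O.ι).isoOpensRange.hom, Scheme.Hom.isoOpensRange_hom_ι_assoc,
    Scheme.Hom.isoOpensRange_hom_ι_assoc, Category.assoc, Category.assoc, ← h1, ← h2]

theorem exists_glue {Y : Scheme.{u}} (N : Z → Z.Opens) (hN : ∀ z, z ∈ N z)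
    (k : ∀ z, (N z).toScheme ⟶ Y)
    (hk : ∀ z w, Limits.pullback.fst (N z).ι (N w).ι ≫ k z =
      Limits.pullback.snd (N z).ι (N w).ι ≫ k w) :
    ∃ h : Z ⟶ Y, ∀ z, (N z).ι ≫ h = k z := by
  let 𝒰 : Z.OpenCover := Z.openCoverOfIsOpenCover N
    (TopologicalSpace.IsOpenCover.mk (eq_top_iff.2 fun z _ =>
      TopologicalSpace.Opens.mem_iSup.2 ⟨z, hN z⟩))
  exact ⟨𝒰.glueMorphisms k hk, fun z => 𝒰.ι_glueMorphisms k hk z⟩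

/-- Every ideal sheaf has a blow-up. -/
theorem isBlowup_blowupProj (I : X.IdealSheafData) : IsBlowup (blowupProj I) I where
  invertible := isInvertible_comap_blowupProj I
  universal Z g Hg := by
    choose c N hzN hc using exists_good_of_isInvertible Hg
    have Hg' : ∀ z, ∃ (U : X.affineOpens) (t : Γ(X, U)), t ∈ I.ideal U ∧ IsGenAt I g U t z :=
      fun z => by
        obtain ⟨s, hs⟩ := (c z).nonempty
        exact ⟨(c z).U, s, (c z).subset s hs, Chart.good_ι_comp_iff.1 (hc z) z (hzN z) s hs⟩
    obtain ⟨h, hh⟩ := exists_glue N hzN (fun z => (hc z).lift ≫ chartι (c z)) fun z w => by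
      refine blowup_hom_ext (g := Limits.pullback.fst (N z).ι (N w).ι ≫ (N z).ι ≫ g)
        (fun y => ?_) ?_ ?_
      · obtain ⟨s, hs⟩ := (c z).nonempty
        exact ⟨(c z).U, s, (c z).subset s hs, (hc z).comp (Limits.pullback.fst (N z).ι (N w).ι)
          y s hs⟩
      · rw [Category.assoc, Category.assoc, chartι_blowupProj, (hc z).lift_proj]
      · rw [Category.assoc, Category.assoc, chartι_blowupProj, (hc w).lift_proj,
          Limits.pullback.condition_assoc]
    refine existsUnique_of_exists_of_unique ⟨h, Scheme.hom_ext_of_forall _ _ fun z =>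
      ⟨N z, hzN z, ?_⟩⟩ fun h h' e e' => blowup_hom_ext Hg' e e'
    rw [← Category.assoc, hh, Category.assoc, chartι_blowupProj, (hc z).lift_proj]

end BlowupConstruction

/-! ### Monomial norms -/

/-- A ring `O` with a ring homomorphism to a normed field `L` on which the norm is monomial: `O`
is expanded into power series with coefficients in its residue field `F`, in such a way that the
coordinates become the variables, and `‖a‖` is the maximum of the weights of the monomials that
occur in the expansion of `a`. The quotients of elements of `O` are dense in `L`. -/
structure MonomialEmbedding (m : ℕ) (O F L : Type*) [CommRing O] [Field F] [NormedField L] where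
  /-- the expansion as a power series -/
  expansion : O →+* MvPowerSeries (Fin m) F
  /-- the residue map -/
  res : O →+* F
  res_surjective : Function.Surjective res
  constantCoeff_expansion : ∀ a, MvPowerSeries.constantCoeff (expansion a) = res a
  /-- the coordinates -/
  coord : Fin m → O
  expansion_coord : ∀ i, expansion (coord i) = MvPowerSeries.X i
  /-- the weights -/
  r : Fin m → ℝ
  r_pos : ∀ i, 0 < r i
  r_lt_one : ∀ i, r i < 1
  /-- the homomorphism to the normed field -/
  toField : O →+* L
  isGreatest : ∀ a, a ≠ 0 →
    IsGreatest {t : ℝ | ∃ I : Fin m →₀ ℕ, MvPowerSeries.coeff I (expansion a) ≠ 0 ∧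
      t = ∏ i, r i ^ I i} ‖toField a‖
  dense : ∀ z : L, ∀ ε > 0, ∃ a b, b ≠ 0 ∧ ‖z - toField a / toField b‖ < ε

namespace MonomialEmbedding

variable {m : ℕ} {O F L : Type*} [CommRing O] [Field F] [NormedField L]
  (E : MonomialEmbedding m O F L)

/-- The weight `r^I` of the exponent `I`. -/
def weight (I : Fin m →₀ ℕ) : ℝ := ∏ i, E.r i ^ I i

theorem weight_pos (I : Fin m →₀ ℕ) : 0 < E.weight I :=
  Finset.prod_pos fun i _ => pow_pos (E.r_pos i) _

@[simp] theorem weight_zero : E.weight 0 = 1 := by simp [weight]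

theorem weight_add (I J : Fin m →₀ ℕ) : E.weight (I + J) = E.weight I * E.weight J := by
  simp [weight, pow_add, Finset.prod_mul_distrib]

theorem weight_lt_one {I : Fin m →₀ ℕ} (hI : I ≠ 0) : E.weight I < 1 := by
  obtain ⟨i, hi⟩ : ∃ i, I i ≠ 0 := by
    by_contra! h
    exact hI (Finsupp.ext h)
  refine (Finset.prod_lt_prod (g := fun _ => (1 : ℝ)) (fun i _ => pow_pos (E.r_pos i) _)
    (fun i _ => pow_le_one₀ (E.r_pos i).le (E.r_lt_one i).le)
    ⟨i, Finset.mem_univ i, pow_lt_one₀ (E.r_pos i).le (E.r_lt_one i) hi⟩).trans_eq (by simp)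

theorem weight_lt {I J : Fin m →₀ ℕ} (h : I < J) : E.weight J < E.weight I := by
  obtain ⟨K, rfl⟩ := exists_add_of_le h.le
  rw [weight_add]
  refine mul_lt_of_lt_one_right (E.weight_pos I) (E.weight_lt_one ?_)
  rintro rfl
  simp at h

theorem weight_anti {I J : Fin m →₀ ℕ} (h : I ≤ J) : E.weight J ≤ E.weight I := by
  obtain rfl | h := eq_or_lt_of_le h
  · rfl
  · exact (E.weight_lt h).le

theorem finite_weight_eq {c : ℝ} (hc : 0 < c) : {I | E.weight I = c}.Finite := by
  choose n hn using fun i => exists_pow_lt_of_lt_one hc (E.r_lt_one i)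
  refine (Set.finite_Iic (Finsupp.equivFunOnFinite.symm n)).subset fun I hI i => ?_
  by_contra! hlt
  have h1 : E.weight I ≤ E.weight (Finsupp.single i (I i)) :=
    E.weight_anti (Finsupp.single_le_iff.2 le_rfl)
  have h2 : E.weight (Finsupp.single i (I i)) = E.r i ^ I i := by
    rw [weight, Finset.prod_eq_single i] <;> simp +contextual [eq_comm]
  have h3 : E.r i ^ I i ≤ E.r i ^ n i :=
    pow_le_pow_of_le_one (E.r_pos i).le (E.r_lt_one i).le hlt.le
  have h4 : E.weight I = c := hI
  linarith [hn i]

/-- The monomial `f^I` in the coordinates. -/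
def monomial (I : Fin m →₀ ℕ) : O := ∏ i, E.coord i ^ I i

theorem expansion_monomial (I : Fin m →₀ ℕ) :
    E.expansion (E.monomial I) = MvPowerSeries.monomial I 1 := by
  rw [monomial, map_prod, MvPowerSeries.monomial_one_eq, Finsupp.prod_fintype _ _ (by simp)]
  simp [E.expansion_coord]

theorem norm_eq_weight {a : O} (ha : a ≠ 0) :
    ∃ I, MvPowerSeries.coeff I (E.expansion a) ≠ 0 ∧ ‖E.toField a‖ = E.weight I :=
  (E.isGreatest a ha).1

theorem weight_le_norm {a : O} (ha : a ≠ 0) {I : Fin m →₀ ℕ}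
    (hI : MvPowerSeries.coeff I (E.expansion a) ≠ 0) : E.weight I ≤ ‖E.toField a‖ :=
  (E.isGreatest a ha).2 ⟨I, hI, rfl⟩

theorem toField_ne_zero {a : O} (ha : a ≠ 0) : E.toField a ≠ 0 := by
  obtain ⟨I, -, h⟩ := E.norm_eq_weight ha
  rw [← norm_ne_zero_iff, h]
  exact (E.weight_pos I).ne'

theorem norm_toField_lt {a : O} {c : ℝ} (hc : 0 < c)
    (h : ∀ I, MvPowerSeries.coeff I (E.expansion a) ≠ 0 → E.weight I < c) :
    ‖E.toField a‖ < c := by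
  by_cases ha : a = 0
  · simpa [ha] using hc
  · obtain ⟨I, hI, e⟩ := E.norm_eq_weight ha
    rw [e]; exact h I hI

theorem norm_toField_le_one (a : O) : ‖E.toField a‖ ≤ 1 := by
  by_cases ha : a = 0
  · simp [ha]
  · obtain ⟨I, -, e⟩ := E.norm_eq_weight ha
    rw [e, ← E.weight_zero]
    exact E.weight_anti zero_le

theorem norm_toField_lt_one_of_res {a : O} (h : E.res a = 0) : ‖E.toField a‖ < 1 := by
  refine E.norm_toField_lt one_pos fun I hI => E.weight_lt_one ?_
  rintro rfl
  rw [← E.constantCoeff_expansion] at h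
  exact hI h

theorem coord_ne_zero (i : Fin m) : E.coord i ≠ 0 := by
  intro h
  have h1 := E.expansion_coord i
  rw [h, map_zero] at h1
  have := congrArg (MvPowerSeries.coeff (Finsupp.single i 1)) h1
  simp [MvPowerSeries.coeff_X] at this

theorem norm_toField_coord (i : Fin m) : ‖E.toField (E.coord i)‖ = E.r i := by
  obtain ⟨I, hI, e⟩ := E.norm_eq_weight (E.coord_ne_zero i)
  rw [E.expansion_coord, MvPowerSeries.coeff_X] at hI
  have hI' : I = Finsupp.single i 1 := by
    by_contra h; simp [h] at hI
  rw [e, hI', weight, Finset.prod_eq_single i] <;>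
    simp +contextual [eq_comm]

theorem norm_toField_monomial (I : Fin m →₀ ℕ) : ‖E.toField (E.monomial I)‖ = E.weight I := by
  simp [monomial, weight, E.norm_toField_coord]

/-- In a combination of monomials of the same weight `c`, only the residues of the coefficients
contribute to the part of the expansion of weight at least `c`. -/
theorem coeff_expansion_sum {τ : Type*} (T : Finset τ) (s : τ → Fin m →₀ ℕ) (w : τ → O) {c : ℝ}
    (hs : ∀ t ∈ T, E.weight (s t) = c) {J : Fin m →₀ ℕ} (hJ : c ≤ E.weight J) :
    MvPowerSeries.coeff J (E.expansion (∑ t ∈ T, w t * E.monomial (s t))) =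
      ∑ t ∈ T, if s t = J then E.res (w t) else 0 := by
  classical
  rw [map_sum, map_sum]
  refine Finset.sum_congr rfl fun t ht => ?_
  rw [map_mul, E.expansion_monomial, MvPowerSeries.coeff_mul_monomial, mul_one]
  by_cases h : s t = J
  · subst h
    rw [if_pos le_rfl, if_pos rfl, tsub_self, ← E.constantCoeff_expansion]
    rfl
  · rw [if_neg h, if_neg]
    intro hle
    have := E.weight_lt (lt_of_le_of_ne hle h)
    rw [hs t ht] at this
    linarith

/-- The leading form: a nonzero element is, up to smaller terms, a finite combination of monomials
whose weight is its norm. -/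
theorem exists_leading_form {a : O} (ha : a ≠ 0) :
    ∃ (T : Finset (Fin m →₀ ℕ)) (w : (Fin m →₀ ℕ) → O),
      (∀ I ∈ T, E.weight I = ‖E.toField a‖) ∧
        ‖E.toField (a - ∑ I ∈ T, w I * E.monomial I)‖ < ‖E.toField a‖ := by
  classical
  have hc : 0 < ‖E.toField a‖ := norm_pos_iff.2 (E.toField_ne_zero ha)
  choose w hw using fun I => E.res_surjective (MvPowerSeries.coeff I (E.expansion a))
  refine ⟨(E.finite_weight_eq hc).toFinset, w, fun I hI => by simpa using hI, ?_⟩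
  refine E.norm_toField_lt hc fun J hJ => ?_
  by_contra! hle
  apply hJ
  rw [map_sub, map_sub, E.coeff_expansion_sum _ (fun I => I) w
    (c := ‖E.toField a‖) (fun I hI => by simpa using hI) hle, Finset.sum_ite_eq']
  split_ifs with hmem
  · rw [hw, sub_self]
  · rw [sub_zero]
    by_contra hne
    exact hmem (by simpa using le_antisymm (E.weight_le_norm ha hne) hle)

end MonomialEmbedding

/-! ### Reduction and the group ring of the relations -/

section Reduction

variable {L : Type*} [NormedField L] [IsUltrametricDist L]

theorem NormedField.mem_valuationSubring_iff {z : L} :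
    z ∈ (NormedField.valuation (K := L)).valuationSubring ↔ ‖z‖ ≤ 1 := by
  rw [Valuation.mem_valuationSubring_iff, NormedField.valuation_apply, ← NNReal.coe_le_coe]
  rfl

open Classical in
/-- The residue class of an element of norm at most one of a non-Archimedean field; the value at
elements of larger norm is `0`. -/
def normReduction (z : L) :
    IsLocalRing.ResidueField (NormedField.valuation (K := L)).valuationSubring :=
  if h : z ∈ (NormedField.valuation (K := L)).valuationSubring then
    IsLocalRing.residue _ ⟨z, h⟩ else 0

theorem normReduction_coe (z : (NormedField.valuation (K := L)).valuationSubring) :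
    normReduction (z : L) = IsLocalRing.residue _ z := dif_pos z.2

theorem normReduction_of_le {z : L} (h : ‖z‖ ≤ 1) :
    normReduction z = IsLocalRing.residue _
      (⟨z, NormedField.mem_valuationSubring_iff.2 h⟩ :
        (NormedField.valuation (K := L)).valuationSubring) :=
  dif_pos _

@[simp] theorem normReduction_one : normReduction (1 : L) = 1 := by
  rw [normReduction_of_le (by simp)]
  exact map_one (IsLocalRing.residue (NormedField.valuation (K := L)).valuationSubring)

@[simp] theorem normReduction_zero : normReduction (0 : L) = 0 := by
  rw [normReduction_of_le (by simp)]
  exact map_zero (IsLocalRing.residue (NormedField.valuation (K := L)).valuationSubring)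

theorem normReduction_mul {y z : L} (hy : ‖y‖ ≤ 1) (hz : ‖z‖ ≤ 1) :
    normReduction (y * z) = normReduction y * normReduction z := by
  have h : ‖y * z‖ ≤ 1 := by
    rw [norm_mul]; exact mul_le_one₀ hy (norm_nonneg _) hz
  rw [normReduction_of_le hy, normReduction_of_le hz, normReduction_of_le h, ← map_mul]
  rfl

theorem normReduction_add {y z : L} (hy : ‖y‖ ≤ 1) (hz : ‖z‖ ≤ 1) :
    normReduction (y + z) = normReduction y + normReduction z := by
  have h : ‖y + z‖ ≤ 1 := (IsUltrametricDist.norm_add_le_max y z).trans (max_le hy hz)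
  rw [normReduction_of_le hy, normReduction_of_le hz, normReduction_of_le h, ← map_add]
  rfl

theorem normReduction_eq_zero_iff {z : L} (hz : ‖z‖ ≤ 1) : normReduction z = 0 ↔ ‖z‖ < 1 := by
  rw [normReduction_of_le hz, IsLocalRing.residue_eq_zero_iff, IsLocalRing.mem_maximalIdeal,
    mem_nonunits_iff, not_iff_comm, not_lt]
  constructor
  · intro h
    have hn : ‖z‖ = 1 := le_antisymm hz h
    have h0 : z ≠ 0 := norm_ne_zero_iff.1 (by rw [hn]; exact one_ne_zero)
    refine IsUnit.of_mul_eq_one ⟨z⁻¹, NormedField.mem_valuationSubring_iff.2 ?_⟩ (Subtype.ext ?_)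
    · rw [norm_inv, hn, inv_one]
    · exact mul_inv_cancel₀ h0
  · intro h
    obtain ⟨w, hw⟩ := h.exists_right_inv
    have h1 : z * (w : L) = 1 := congrArg Subtype.val hw
    have h2 : ‖(w : L)‖ ≤ 1 := NormedField.mem_valuationSubring_iff.1 w.2
    have h3 := congrArg norm h1
    rw [norm_mul, norm_one] at h3
    nlinarith [norm_nonneg z]

theorem normReduction_eq_of_norm_sub_lt {y z : L} (hz : ‖z‖ ≤ 1) (h : ‖y - z‖ < 1) :
    normReduction y = normReduction z := by
  have h1 := normReduction_add h.le hz
  rwa [sub_add_cancel, (normReduction_eq_zero_iff h.le).2 h, zero_add] at h1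

theorem normReduction_div {y z : L} (hy : ‖y‖ ≤ 1) (hz : ‖z‖ = 1) :
    normReduction (y / z) = normReduction y / normReduction z := by
  have h0 : normReduction z ≠ 0 := by
    rw [Ne, normReduction_eq_zero_iff hz.le, hz]; simp
  have hz0 : z ≠ 0 := norm_ne_zero_iff.1 (by rw [hz]; exact one_ne_zero)
  rw [eq_div_iff h0, ← normReduction_mul (by rw [norm_div, hz, div_one]; exact hy) hz.le,
    div_mul_cancel₀ _ hz0]

theorem norm_sum_le_one {τ : Type*} (T : Finset τ) (y : τ → L) (hy : ∀ t ∈ T, ‖y t‖ ≤ 1) :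
    ‖∑ t ∈ T, y t‖ ≤ 1 :=
  NormedField.mem_valuationSubring_iff.1
    (sum_mem fun t ht => NormedField.mem_valuationSubring_iff.2 (hy t ht))

theorem normReduction_sum {τ : Type*} (T : Finset τ) (y : τ → L) (hy : ∀ t ∈ T, ‖y t‖ ≤ 1) :
    normReduction (∑ t ∈ T, y t) = ∑ t ∈ T, normReduction (y t) := by
  classical
  induction T using Finset.induction_on with
  | empty => simp
  | insert t T ht ih =>
    have h1 : ∀ t ∈ T, ‖y t‖ ≤ 1 := fun s hs => hy s (Finset.mem_insert_of_mem hs)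
    rw [Finset.sum_insert ht, Finset.sum_insert ht, ← ih h1]
    exact normReduction_add (hy t (Finset.mem_insert_self _ _)) (norm_sum_le_one T y h1)

end Reduction

/-- Finitely many integral vectors become nonnegative after adding a suitable vector. -/
theorem exists_add_nonneg {m : ℕ} (T : Finset (Fin m → ℤ)) :
    ∃ (N : Fin m →₀ ℕ) (w : (Fin m → ℤ) → Fin m →₀ ℕ), ∀ v ∈ T, ∀ i, (w v i : ℤ) = v i + N i := by
  let N : Fin m →₀ ℕ := Finsupp.equivFunOnFinite.symm fun i => ∑ v ∈ T, (v i).natAbs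
  refine ⟨N, fun v => Finsupp.equivFunOnFinite.symm fun i => (v i + N i).toNat, fun v hv i => ?_⟩
  have h1 : (v i).natAbs ≤ N i :=
    Finset.single_le_sum (f := fun v : Fin m → ℤ => (v i).natAbs) (fun _ _ => Nat.zero_le _) hv
  rw [Finsupp.equivFunOnFinite_symm_apply_apply]
  omega

namespace MonomialEmbedding

variable {m : ℕ} {O F L : Type*} [CommRing O] [Field F] [NormedField L]
  (E : MonomialEmbedding m O F L)

/-- The Laurent monomial `f^I` in the coordinates. -/
def laurent (I : Fin m → ℤ) : L := ∏ i, E.toField (E.coord i) ^ I i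

theorem toField_coord_ne_zero (i : Fin m) : E.toField (E.coord i) ≠ 0 :=
  E.toField_ne_zero (E.coord_ne_zero i)

theorem laurent_ne_zero (I : Fin m → ℤ) : E.laurent I ≠ 0 :=
  Finset.prod_ne_zero_iff.2 fun i _ => zpow_ne_zero _ (E.toField_coord_ne_zero i)

theorem laurent_add (I J : Fin m → ℤ) : E.laurent (I + J) = E.laurent I * E.laurent J := by
  simp [laurent, zpow_add₀ (E.toField_coord_ne_zero _), Finset.prod_mul_distrib]

@[simp] theorem laurent_zero : E.laurent 0 = 1 := by simp [laurent]

theorem laurent_natCast (I : Fin m →₀ ℕ) :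
    E.laurent (fun i => (I i : ℤ)) = E.toField (E.monomial I) := by
  simp [laurent, monomial]

theorem norm_laurent_pos (I : Fin m → ℤ) : 0 < ‖E.laurent I‖ :=
  norm_pos_iff.2 (E.laurent_ne_zero I)

theorem log_norm_laurent (I : Fin m → ℤ) :
    Real.log ‖E.laurent I‖ = ∑ i, (I i : ℝ) * Real.log (E.r i) := by
  rw [laurent, norm_prod, Real.log_prod fun i _ =>
    norm_ne_zero_iff.2 (zpow_ne_zero _ (E.toField_coord_ne_zero i))]
  simp [norm_zpow, E.norm_toField_coord, Real.log_zpow]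

theorem mem_weightRelations_iff (I : Fin m → ℤ) :
    I ∈ weightRelations E.r ↔ ‖E.laurent I‖ = 1 := by
  change ∑ i, (I i : ℝ) * Real.log (E.r i) = 0 ↔ _
  rw [← log_norm_laurent]
  constructor
  · intro h
    rcases Real.log_eq_zero.1 h with h | h | h
    · exact absurd h (E.norm_laurent_pos I).ne'
    · exact h
    · linarith [E.norm_laurent_pos I]
  · intro h
    rw [h, Real.log_one]

theorem norm_laurent (I : weightRelations E.r) : ‖E.laurent I‖ = 1 :=
  (E.mem_weightRelations_iff _).1 I.2

variable [IsUltrametricDist L]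

/-- The residue classes of the Laurent monomials of norm one. -/
def relationHom : Multiplicative (weightRelations E.r) →*
    IsLocalRing.ResidueField (NormedField.valuation (K := L)).valuationSubring where
  toFun I := normReduction (E.laurent (Multiplicative.toAdd I).1)
  map_one' := by
    change normReduction (E.laurent 0) = 1
    simp
  map_mul' I J := by
    change normReduction (E.laurent (_ + _)) = _
    rw [laurent_add, normReduction_mul (E.norm_laurent _).le (E.norm_laurent _).le]

variable [Algebra F (IsLocalRing.ResidueField (NormedField.valuation (K := L)).valuationSubring)]

/-- The homomorphism from the group ring of the relations between the weights to the residue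
field. -/
def groupRingHom : AddMonoidAlgebra F (weightRelations E.r) →ₐ[F]
    IsLocalRing.ResidueField (NormedField.valuation (K := L)).valuationSubring :=
  AddMonoidAlgebra.lift F _ _ E.relationHom

theorem groupRingHom_single (I : weightRelations E.r) (c : F) :
    E.groupRingHom (AddMonoidAlgebra.single I c) =
      algebraMap F _ c * normReduction (E.laurent I) := by
  rw [groupRingHom, AddMonoidAlgebra.lift_single, Algebra.smul_def]
  rfl

/-- The constants of the residue field are the residue classes of elements of `O`. -/
def IsCompatible : Prop := ∀ a : O, algebraMap F _ (E.res a) = normReduction (E.toField a)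

variable {E}

/-- A combination of monomials of equal weight, divided by one of them, reduces to an element of
the group ring. -/
theorem normReduction_sum_monomial (hE : E.IsCompatible) {τ : Type*} (T : Finset τ)
    (w : τ → O) (I : τ → weightRelations E.r) :
    normReduction (∑ t ∈ T, E.toField (w t) * E.laurent (I t)) =
      E.groupRingHom (∑ t ∈ T, AddMonoidAlgebra.single (I t) (E.res (w t))) := by
  have h1 : ∀ t, ‖E.toField (w t)‖ ≤ 1 := fun t => E.norm_toField_le_one _
  have h2 : ∀ t, ‖E.laurent (I t)‖ ≤ 1 := fun t => (E.norm_laurent _).le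
  rw [normReduction_sum _ _ fun t _ => by
    rw [norm_mul]; exact mul_le_one₀ (h1 t) (norm_nonneg _) (h2 t), map_sum]
  refine Finset.sum_congr rfl fun t _ => ?_
  rw [normReduction_mul (h1 t) (h2 t), groupRingHom_single, hE]

/-- A nonzero element of the group ring lifts to an element of norm one: distinct relations occur
as distinct monomials of equal weight in a power series expansion, so they cannot cancel. -/
theorem groupRingHom_injective (hE : E.IsCompatible) : Function.Injective E.groupRingHom := by
  classical
  rw [injective_iff_map_eq_zero]
  intro A hA
  by_contra hne
  let T := A.coeff.support
  obtain ⟨N, s', hs'⟩ := exists_add_nonneg (T.image Subtype.val)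
  let s : weightRelations E.r → Fin m →₀ ℕ := fun I => s' I.1
  have hN : ∀ I ∈ T, ∀ i, (s I i : ℤ) = I.1 i + N i := fun I hI =>
    hs' I.1 (Finset.mem_image_of_mem _ hI)
  have hs : ∀ I ∈ T, E.toField (E.monomial (s I)) = E.laurent I.1 * E.toField (E.monomial N) := by
    intro I hI
    rw [← laurent_natCast, ← laurent_natCast, ← laurent_add]
    congr 1
    funext i
    exact hN I hI i
  -- after the shift by `N`, a lift of `A` is an element `a` of `O`, whose expansion has a term of
  -- weight `r^N`; hence the lift of `A` has norm at least one
  choose w hw using fun I => E.res_surjective (A.coeff I)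
  let a : O := ∑ I ∈ T, w I * E.monomial (s I)
  have ha : E.toField a = (∑ I ∈ T, E.toField (w I) * E.laurent I.1) *
      E.toField (E.monomial N) := by
    rw [map_sum, Finset.sum_mul]
    refine Finset.sum_congr rfl fun I hI => ?_
    rw [map_mul, hs I hI, mul_assoc]
  have hweight : ∀ I ∈ T, E.weight (s I) = E.weight N := fun I hI => by
    rw [← norm_toField_monomial, ← norm_toField_monomial, hs I hI, norm_mul, E.norm_laurent,
      one_mul]
  obtain ⟨I₀, hI₀⟩ : T.Nonempty := by
    rw [Finsupp.support_nonempty_iff]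
    simpa using hne
  have hcoeff : MvPowerSeries.coeff (s I₀) (E.expansion a) ≠ 0 := by
    rw [E.coeff_expansion_sum T s w hweight (hweight I₀ hI₀).ge, Finset.sum_eq_single I₀]
    · rw [if_pos rfl, hw]
      exact Finsupp.mem_support_iff.1 hI₀
    · intro I hI hII₀
      rw [if_neg]
      intro h
      apply hII₀
      apply Subtype.ext
      funext i
      have h1 : s I i = s I₀ i := DFunLike.congr_fun h i
      have := hN I hI i
      have := hN I₀ hI₀ i
      omega
    · intro h; exact absurd hI₀ h
  have ha0 : a ≠ 0 := by
    rintro h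
    rw [h] at hcoeff
    simp at hcoeff
  have hnorm := E.weight_le_norm ha0 hcoeff
  rw [hweight I₀ hI₀, ha, norm_mul, norm_toField_monomial] at hnorm
  have h1 : 1 ≤ ‖∑ I ∈ T, E.toField (w I) * E.laurent I.1‖ :=
    le_of_mul_le_mul_right (by rwa [one_mul]) (E.weight_pos N)
  have h2 := normReduction_sum_monomial hE T w (fun I => I)
  have h3 : (∑ I ∈ T, AddMonoidAlgebra.single I (E.res (w I))) = A := by
    simp_rw [hw]
    exact AddMonoidAlgebra.sum_coeff_single A
  rw [h3, hA, normReduction_eq_zero_iff] at h2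
  · linarith
  · exact norm_sum_le_one _ _ fun I _ => by
      rw [norm_mul]
      exact mul_le_one₀ (E.norm_toField_le_one _) (norm_nonneg _) (E.norm_laurent _).le

/-- The residue class of a nonzero element of `O`, divided by a monomial of the same norm, lies in
the image of the group ring. -/
theorem exists_groupRingHom_eq (hE : E.IsCompatible) {a : O} (ha : a ≠ 0) {I₀ : Fin m →₀ ℕ}
    (hI₀ : ‖E.toField a‖ = E.weight I₀) :
    ∃ A, normReduction (E.toField a / E.toField (E.monomial I₀)) = E.groupRingHom A := by
  obtain ⟨T, w, hT, hlt⟩ := E.exists_leading_form ha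
  have hmon : ∀ I : Fin m →₀ ℕ, E.toField (E.monomial I) ≠ 0 := fun I =>
    norm_ne_zero_iff.1 (by rw [E.norm_toField_monomial]; exact (E.weight_pos I).ne')
  have hrel : ∀ I : Fin m →₀ ℕ, E.laurent (fun i => (I i : ℤ) - I₀ i) =
      E.toField (E.monomial I) / E.toField (E.monomial I₀) := fun I => by
    rw [eq_div_iff (hmon I₀), ← laurent_natCast, ← laurent_natCast, ← laurent_add]
    congr 1
    funext i
    simp
  have hmem : ∀ I ∈ T, (fun i => (I i : ℤ) - I₀ i) ∈ weightRelations E.r := fun I hI => by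
    rw [E.mem_weightRelations_iff, hrel, norm_div, E.norm_toField_monomial,
      E.norm_toField_monomial, hT I hI, hI₀, div_self (E.weight_pos I₀).ne']
  refine ⟨_, Eq.trans ?_ (normReduction_sum_monomial hE T.attach (fun I => w I.1)
    fun I => ⟨_, hmem I.1 I.2⟩)⟩
  have hsum : (∑ I ∈ T.attach, E.toField (w I.1) * E.laurent (fun i => (I.1 i : ℤ) - I₀ i)) =
      E.toField (∑ I ∈ T, w I * E.monomial I) / E.toField (E.monomial I₀) := by
    rw [Finset.sum_attach T fun I => E.toField (w I) * E.laurent (fun i => (I i : ℤ) - I₀ i),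
      map_sum, Finset.sum_div]
    refine Finset.sum_congr rfl fun I _ => ?_
    rw [map_mul, hrel, mul_div_assoc]
  apply normReduction_eq_of_norm_sub_lt
  · refine norm_sum_le_one _ _ fun I _ => ?_
    rw [norm_mul]
    exact mul_le_one₀ (E.norm_toField_le_one _) (norm_nonneg _)
      ((E.mem_weightRelations_iff _).1 (hmem I.1 I.2)).le
  · rw [hsum, ← sub_div, ← map_sub, norm_div, E.norm_toField_monomial, ← hI₀, div_lt_one]
    · exact hlt
    · exact norm_pos_iff.2 (E.toField_ne_zero ha)

/-- The residue field is the field of fractions of the group ring. -/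
theorem exists_div_eq (hE : E.IsCompatible)
    (z : IsLocalRing.ResidueField (NormedField.valuation (K := L)).valuationSubring) :
    ∃ A B, B ≠ 0 ∧ z = E.groupRingHom A / E.groupRingHom B := by
  obtain ⟨z, rfl⟩ := IsLocalRing.residue_surjective z
  obtain ⟨a, b, hb, hab⟩ := E.dense z 1 one_pos
  rw [← normReduction_coe]
  have hz : ‖(z : L)‖ ≤ 1 := NormedField.mem_valuationSubring_iff.1 z.2
  have h1 : normReduction (E.toField a / E.toField b) = normReduction (z : L) :=
    normReduction_eq_of_norm_sub_lt hz (by rwa [norm_sub_rev])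
  by_cases hz1 : ‖(z : L)‖ < 1
  · refine ⟨0, 1, one_ne_zero, ?_⟩
    rw [(normReduction_eq_zero_iff hz).2 hz1, map_zero, zero_div]
  have hz1 : ‖(z : L)‖ = 1 := le_antisymm hz (not_lt.1 hz1)
  have hnorm : ‖E.toField a / E.toField b‖ = 1 := by
    have hle : ‖E.toField a / E.toField b‖ ≤ 1 := by
      have := IsUltrametricDist.norm_add_le_max (z : L) (E.toField a / E.toField b - z)
      rw [add_sub_cancel, norm_sub_rev _ (z : L)] at this
      exact this.trans (max_le hz hab.le)
    refine le_antisymm hle (not_lt.1 fun hlt => ?_)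
    rw [(normReduction_eq_zero_iff hle).2 hlt, eq_comm, normReduction_eq_zero_iff hz] at h1
    linarith
  have hb0 : E.toField b ≠ 0 := E.toField_ne_zero hb
  have ha : a ≠ 0 := by
    rintro rfl
    simp at hnorm
  rw [norm_div, div_eq_one_iff_eq (norm_ne_zero_iff.2 hb0)] at hnorm
  obtain ⟨I₀, -, hI₀⟩ := E.norm_eq_weight hb
  have hmon : ‖E.toField (E.monomial I₀)‖ = ‖E.toField b‖ := by
    rw [E.norm_toField_monomial, hI₀]
  have hmon0 : E.toField (E.monomial I₀) ≠ 0 :=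
    norm_ne_zero_iff.1 (by rw [hmon]; exact norm_ne_zero_iff.2 hb0)
  obtain ⟨A, hA⟩ := exists_groupRingHom_eq hE ha (hnorm.trans hI₀)
  obtain ⟨B, hB⟩ := exists_groupRingHom_eq hE hb hI₀
  have hbn : ‖E.toField b / E.toField (E.monomial I₀)‖ = 1 := by
    rw [norm_div, hmon, div_self (norm_ne_zero_iff.2 hb0)]
  have han : ‖E.toField a / E.toField (E.monomial I₀)‖ = 1 := by
    rw [norm_div, hmon, hnorm, div_self (norm_ne_zero_iff.2 hb0)]
  refine ⟨A, B, ?_, ?_⟩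
  · rintro rfl
    rw [map_zero, normReduction_eq_zero_iff hbn.le] at hB
    linarith
  · rw [← hA, ← hB, ← normReduction_div han.le hbn, ← h1, div_div_div_cancel_right₀ hmon0]

end MonomialEmbedding

/-! ### Rational rank and rational function fields -/

/-- The relations between the weights form a free group, whose rank and the dimension of the
`ℚ`-vector space spanned by the logarithms of the weights add up to the number of weights. -/
theorem exists_basis_weightRelations {m : ℕ} (r : Fin m → ℝ) :
    ∃ n d : ℕ, n + d = m ∧
      Module.rank ℚ (Submodule.span ℚ (Set.range fun i => Real.log (r i))) = n ∧
      Nonempty (Module.Basis (Fin d) ℤ (weightRelations r)) := by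
  let f : (Fin m → ℤ) →ₗ[ℤ] ℝ := Fintype.linearCombination ℤ fun i => Real.log (r i)
  have hker : LinearMap.ker f = AddSubgroup.toIntSubmodule (weightRelations r) := by
    ext I
    change ∑ i, I i • Real.log (r i) = 0 ↔ ∑ i, (I i : ℝ) * Real.log (r i) = 0
    simp only [zsmul_eq_mul]
  have hrange : LinearMap.range f = Submodule.span ℤ (Set.range fun i => Real.log (r i)) :=
    Fintype.range_linearCombination _ _
  have hrank : Module.finrank ℤ (LinearMap.range f) + Module.finrank ℤ (LinearMap.ker f) = m := by
    rw [← f.quotKerEquivRange.finrank_eq, Submodule.finrank_quotient_add_finrank,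
      Module.finrank_fin_fun]
  -- a `ℤ`-basis of the group generated by the logarithms is also a `ℚ`-basis of its span
  obtain ⟨b⟩ : Nonempty (Module.Basis (Fin (Module.finrank ℤ (LinearMap.range f))) ℤ
    (LinearMap.range f)) := ⟨Module.finBasis ℤ _⟩
  have hb : LinearIndependent ℚ fun j => (b j : ℝ) := by
    rw [← LinearIndependent.iff_fractionRing ℤ ℚ]
    exact b.linearIndependent.map' _ (LinearMap.range f).ker_subtype
  have hspan : Submodule.span ℚ (Set.range fun i => Real.log (r i)) =
      Submodule.span ℚ (Set.range fun j => (b j : ℝ)) := by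
    have h1 : Submodule.span ℤ (Set.range fun j => (b j : ℝ)) =
        Submodule.span ℤ (Set.range fun i => Real.log (r i)) := by
      have := congrArg (Submodule.map (LinearMap.range f).subtype) b.span_eq
      rw [Submodule.map_span, Submodule.map_top, Submodule.range_subtype, ← Set.range_comp] at this
      exact this.trans hrange
    rw [← Submodule.span_span_of_tower ℤ ℚ, ← h1, Submodule.span_span_of_tower]
  refine ⟨_, _, hrank, ?_, ⟨?_⟩⟩
  · rw [hspan, rank_span hb, Cardinal.mk_range_eq _ hb.injective, Cardinal.mk_fin]
  · exact (Module.finBasis ℤ (LinearMap.ker f)).map (LinearEquiv.ofEq _ _ hker)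

namespace MonomialEmbedding

variable {m : ℕ} {O F L : Type*} [CommRing O] [Field F] [NormedField L]
  (E : MonomialEmbedding m O F L)

/-- The logarithms of the norms on `L` and of the weights span the same `ℚ`-vector space: every norm
is the norm of a quotient of elements of `O`, hence a quotient of two weights of exponents. -/
theorem span_log_norm [IsUltrametricDist L] :
    Submodule.span ℚ (Set.range fun z : Lˣ => Real.log ‖(z : L)‖) =
      Submodule.span ℚ (Set.range fun i => Real.log (E.r i)) := by
  have hlog : ∀ I : Fin m →₀ ℕ, Real.log (E.weight I) ∈
      Submodule.span ℚ (Set.range fun i => Real.log (E.r i)) := fun I => by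
    rw [weight, Real.log_prod fun i _ => (pow_pos (E.r_pos i) _).ne']
    refine sum_mem fun i _ => ?_
    rw [Real.log_pow, ← nsmul_eq_mul]
    exact nsmul_mem (Submodule.subset_span (Set.mem_range_self i)) _
  apply le_antisymm
  · rw [Submodule.span_le]
    rintro _ ⟨z, rfl⟩
    obtain ⟨a, b, hb, hab⟩ := E.dense z ‖(z : L)‖ (norm_pos_iff.2 z.ne_zero)
    have hnorm : ‖(z : L)‖ = ‖E.toField a / E.toField b‖ := by
      rw [norm_sub_rev] at hab
      have := IsUltrametricDist.norm_add_eq_max_of_norm_ne_norm hab.ne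
      rw [sub_add_cancel, max_eq_right hab.le] at this
      exact this.symm
    have ha : a ≠ 0 := by
      rintro rfl
      rw [map_zero, zero_div, norm_zero] at hnorm
      exact z.ne_zero (norm_eq_zero.1 hnorm)
    obtain ⟨I, -, hI⟩ := E.norm_eq_weight ha
    obtain ⟨J, -, hJ⟩ := E.norm_eq_weight hb
    change Real.log ‖(z : L)‖ ∈ Submodule.span ℚ (Set.range fun i => Real.log (E.r i))
    rw [hnorm, norm_div, hI, hJ, Real.log_div (E.weight_pos I).ne' (E.weight_pos J).ne']
    exact sub_mem (hlog I) (hlog J)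
  · rw [Submodule.span_le]
    rintro _ ⟨i, rfl⟩
    refine Submodule.subset_span ⟨Units.mk0 _ (E.toField_coord_ne_zero i), ?_⟩
    simp [E.norm_toField_coord]

variable [IsUltrametricDist L]
  [Algebra F (IsLocalRing.ResidueField (NormedField.valuation (K := L)).valuationSubring)]
  {E} {ι : Type*}

/-- The residue classes of the Laurent monomials with exponents in a basis of the group of
relations generate the residue field. -/
theorem eq_top_of_mem (b : Module.Basis ι ℤ (weightRelations E.r)) (hE : E.IsCompatible)
    (K : IntermediateField F
      (IsLocalRing.ResidueField (NormedField.valuation (K := L)).valuationSubring))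
    (hK : ∀ j, normReduction (E.laurent (b j)) ∈ K) : K = ⊤ := by
  let S : AddSubgroup (weightRelations E.r) :=
    { carrier := {I | E.relationHom (Multiplicative.ofAdd I) ∈ K}
      zero_mem' := by
        change E.relationHom 1 ∈ K
        rw [map_one]; exact one_mem K
      add_mem' := fun {I J} hI hJ => by
        change E.relationHom (Multiplicative.ofAdd I * Multiplicative.ofAdd J) ∈ K
        rw [map_mul]; exact mul_mem hI hJ
      neg_mem' := fun {I} hI => by
        change E.relationHom (Multiplicative.ofAdd I)⁻¹ ∈ K
        have h : E.relationHom (Multiplicative.ofAdd I)⁻¹ =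
            (E.relationHom (Multiplicative.ofAdd I))⁻¹ := by
          apply eq_inv_of_mul_eq_one_left
          rw [← map_mul, inv_mul_cancel, map_one]
        rw [h]; exact inv_mem hI }
  have hS : ∀ I, I ∈ S := by
    have h : Submodule.span ℤ (Set.range b) ≤ AddSubgroup.toIntSubmodule S :=
      Submodule.span_le.2 (by rintro _ ⟨j, rfl⟩; exact hK j)
    rw [b.span_eq] at h
    exact fun I => h trivial
  have hΨ : ∀ A, E.groupRingHom A ∈ K := by
    intro A
    rw [← AddMonoidAlgebra.sum_coeff_single A, Finsupp.sum, map_sum]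
    refine sum_mem fun I _ => ?_
    rw [groupRingHom_single]
    exact mul_mem (K.algebraMap_mem _) (hS I)
  rw [eq_top_iff]
  rintro z -
  obtain ⟨A, B, -, rfl⟩ := exists_div_eq hE z
  exact div_mem (hΨ A) (hΨ B)

theorem fg_top [Finite ι] (b : Module.Basis ι ℤ (weightRelations E.r))
    (hE : E.IsCompatible) : (⊤ : IntermediateField F
    (IsLocalRing.ResidueField (NormedField.valuation (K := L)).valuationSubring)).FG := by
  rw [← eq_top_of_mem b hE (IntermediateField.adjoin F
    (Set.range fun j => normReduction (E.laurent (b j)))) fun j =>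
      IntermediateField.subset_adjoin _ _ ⟨j, rfl⟩]
  exact IntermediateField.fg_adjoin_of_finite (Set.finite_range _)

/-- The residue classes of the Laurent monomials with exponents in a basis of the group of
relations are algebraically independent over `F`. -/
theorem aeval_injective (b : Module.Basis ι ℤ (weightRelations E.r))
    (hE : E.IsCompatible) : Function.Injective
    (MvPolynomial.aeval (R := F) fun j => normReduction (E.laurent (b j))) := by
  -- polynomials in the basis elements form a subring of the group ring
  let φ : (ι →₀ ℕ) →+ weightRelations E.r :=
    (Finsupp.linearCombination ℤ b).toAddMonoidHom.comp
      (Finsupp.mapRange.addMonoidHom (Nat.castAddMonoidHom ℤ))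
  have hφ : Function.Injective φ := by
    refine Function.Injective.comp (g := Finsupp.linearCombination ℤ b) b.linearIndependent ?_
    exact Finsupp.mapRange_injective _ rfl Nat.cast_injective
  have h : MvPolynomial.aeval (R := F) (fun j => normReduction (E.laurent (b j))) =
      E.groupRingHom.comp (AddMonoidAlgebra.mapDomainAlgHom F F φ) := by
    refine MvPolynomial.algHom_ext fun j => ?_
    rw [MvPolynomial.aeval_X]
    change _ = E.groupRingHom (AddMonoidAlgebra.mapDomain φ
      (AddMonoidAlgebra.single (Finsupp.single j 1) 1))
    rw [AddMonoidAlgebra.mapDomain_single, groupRingHom_single, map_one, one_mul]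
    congr 2
    simp [φ]
  rw [h]
  exact (groupRingHom_injective hE).comp (AddMonoidAlgebra.mapDomain_injective hφ)

/-- The residue field is a rational function field over `F`, with one variable for each element of
a basis of the group of relations between the weights. -/
theorem nonempty_algEquiv (b : Module.Basis ι ℤ (weightRelations E.r))
    (hE : E.IsCompatible) :
    Nonempty (IsLocalRing.ResidueField (NormedField.valuation (K := L)).valuationSubring ≃ₐ[F]
      FractionRing (MvPolynomial ι F)) := by
  let ψ : FractionRing (MvPolynomial ι F) →ₐ[F]
      IsLocalRing.ResidueField (NormedField.valuation (K := L)).valuationSubring :=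
    IsFractionRing.liftAlgHom (aeval_injective b hE)
  have hψ : ψ.fieldRange = ⊤ := eq_top_of_mem b hE _ fun j =>
    ⟨algebraMap _ _ (MvPolynomial.X j), by
      refine (IsFractionRing.lift_algebraMap (aeval_injective b hE) _).trans ?_
      exact MvPolynomial.aeval_X _ j⟩
  exact ⟨(AlgEquiv.ofBijective ψ ⟨ψ.injective, AlgHom.fieldRange_eq_top.1 hψ⟩).symm⟩

end MonomialEmbedding

/-! ### The center of a monomial valuation -/

namespace BerkovichPoint

section

variable {k : Type u} [Field k] {X : Scheme.{u}} {s : X ⟶ Spec (.of k)} (x : BerkovichPoint s)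

theorem norm_toH (f : X.residueField x.pt) : ‖x.toH f‖ = x.abv f :=
  UniformSpace.Completion.norm_coe (E := WithAbs x.abv) _

theorem exists_norm_sub_toH_lt (z : x.H) {ε : ℝ} (hε : 0 < ε) : ∃ f, ‖z - x.toH f‖ < ε := by
  have h := Metric.denseRange_iff.1
    (UniformSpace.Completion.denseRange_coe (α := WithAbs x.abv)) z ε hε
  obtain ⟨f, hf⟩ := h
  refine ⟨WithAbs.equiv x.abv f, ?_⟩
  rw [dist_eq_norm] at hf
  exact hf

theorem exists_stalkToField_div_eq [IsIntegral X] (hpt : x.pt = genericPoint X) {p : X}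
    (h : x.pt ⤳ p) (f : X.residueField x.pt) :
    ∃ a b, b ≠ 0 ∧ f = x.stalkToField h a / x.stalkToField h b := by
  obtain ⟨pt, abv, h₁, h₂⟩ := x
  dsimp only at hpt h f
  subst hpt
  obtain ⟨g, rfl⟩ := X.residue_surjective _ f
  obtain ⟨a, b, hb, rfl⟩ := IsFractionRing.div_surjective (A := X.presheaf.stalk p)
    (K := X.functionField) g
  refine ⟨a, b, nonZeroDivisors.ne_zero hb, ?_⟩
  exact map_div₀ (X.residue (genericPoint X)).hom _ _

/-- The homomorphism from the local ring at the center to the valuation ring is the evaluation. -/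
theorem CenterOn.coe_stalkToIntegers {x : BerkovichPoint s} (c : x.CenterOn (𝟙 X))
    (h : x.pt ⤳ c.center) (a : X.presheaf.stalk c.center) :
    (c.stalkToIntegers a : x.H) = x.toH (x.stalkToField h a) := by
  have h1 : CommRingCat.ofHom (x.integers.subtype.comp c.stalkToIntegers) =
      CommRingCat.ofHom (x.toH.comp (x.stalkToField h)) := by
    rw [← Spec.map_inj, ← cancel_mono (X.fromSpecStalk c.center)]
    have h2 := c.comm
    rw [Category.comp_id, specInclusion,
      ← Scheme.Spec_stalkClosedPointTo_fromSpecStalk (R := .of x.integers) c.hom] at h2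
    have h3 : Spec.map (CommRingCat.ofHom (x.toH.comp (x.stalkToField h))) =
        Spec.map (CommRingCat.ofHom x.toH) ≫ Spec.map (X.residue x.pt) ≫
          Spec.map (X.presheaf.stalkSpecializes h) := by
      rw [← Spec.map_comp, ← Spec.map_comp]
      rfl
    rw [h3, Category.assoc, Category.assoc, X.SpecMap_stalkSpecializes_fromSpecStalk]
    refine Eq.trans ?_ h2
    rw [← Category.assoc, ← Spec.map_comp]
    rfl
  exact DFunLike.congr_fun (congrArg CommRingCat.Hom.hom h1) a

end

namespace IsMonomial

variable {k : Type u} [Field k] {X : Scheme.{u}} [IsIntegral X] {s : X ⟶ Spec (.of k)}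
  {x : BerkovichPoint s} {p : X} {m : ℕ} {D : CohenCoordinates X p m} {r : Fin m → ℝ}
  (hx : x.IsMonomial D r)

/-- The monomial embedding of the local ring `𝒪_{X,p}` into `ℋ(x)`. -/
def embedding : MonomialEmbedding m (X.presheaf.stalk p) (X.residueField p) x.H where
  expansion := D.iso.toRingHom.comp (algebraMap _ _)
  res := (X.residue p).hom
  res_surjective := X.residue_surjective p
  constantCoeff_expansion := D.iso_residue
  coord := D.coord
  expansion_coord := D.iso_coord
  r := r
  r_pos := hx.pos
  r_lt_one := hx.lt_one
  toField := x.toH.comp (x.stalkToField hx.specializes)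
  isGreatest a ha := by
    have h := hx.isGreatest a ha
    rw [← norm_toH] at h
    exact h
  dense z ε hε := by
    obtain ⟨f, hf⟩ := x.exists_norm_sub_toH_lt z hε
    obtain ⟨a, b, hb, rfl⟩ := x.exists_stalkToField_div_eq hx.pt_eq hx.specializes f
    exact ⟨a, b, hb, by rwa [map_div₀] at hf⟩

/-- The local homomorphism `𝒪_{X,p} → ℋ(x)°`. -/
def stalkToIntegers : X.presheaf.stalk p →+* x.integers :=
  (x.toH.comp (x.stalkToField hx.specializes)).codRestrict x.integers fun a =>
    (x.mem_integers _).2 (hx.embedding.norm_toField_le_one a)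

instance : IsLocalHom hx.stalkToIntegers where
  map_nonunit a ha := by
    by_contra hna
    have h1 : (X.residue p).hom a = 0 :=
      (IsLocalRing.residue_eq_zero_iff a).2 ((IsLocalRing.mem_maximalIdeal a).2 hna)
    have h2 := hx.embedding.norm_toField_lt_one_of_res h1
    obtain ⟨w, hw⟩ := ha.exists_right_inv
    have h3 := congrArg (fun z : x.integers => ‖(z : x.H)‖) hw
    have h4 : ‖hx.embedding.toField a‖ * ‖(w : x.H)‖ = 1 := by
      rw [← norm_mul, ← norm_one (α := x.H)]
      exact h3
    have h5 : ‖(w : x.H)‖ ≤ 1 := (x.mem_integers _).1 w.2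
    nlinarith [norm_nonneg (hx.embedding.toField a)]

/-- The center of a monomial valuation on `X`. -/
def centerOn : x.CenterOn (𝟙 X) where
  hom := Spec.map (CommRingCat.ofHom hx.stalkToIntegers) ≫ X.fromSpecStalk p
  comm := by
    rw [Category.comp_id, specInclusion, toScheme, Scheme.fromSpecResidueField,
      ← X.SpecMap_stalkSpecializes_fromSpecStalk hx.specializes]
    simp only [← Category.assoc, ← Spec.map_comp]
    rfl

theorem centerOn_center : hx.centerOn.center = p := by
  have h : IsLocalHom (CommRingCat.ofHom hx.stalkToIntegers).hom :=
    inferInstanceAs (IsLocalHom hx.stalkToIntegers)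
  refine (Scheme.Hom.comp_apply (Spec.map (CommRingCat.ofHom hx.stalkToIntegers))
    (X.fromSpecStalk p) _).trans ?_
  refine Eq.trans (congrArg (X.fromSpecStalk p) ?_) (Scheme.fromSpecStalk_closedPoint (x := p))
  exact Spec_closedPoint (f := CommRingCat.ofHom hx.stalkToIntegers)

end IsMonomial

end BerkovichPoint

/-! ### Lifting the center to a blow-up -/

namespace BlowupConstruction

variable {X : Scheme.{u}}

/-- The ideal sheaf of the sections that become multiples of `g` in the ring `R`, for a morphism
`Spec R ⟶ X` and `g ∈ R`. -/
def multiplesIdeal {R : CommRingCat.{u}} (f : Spec R ⟶ X) (g : R) : X.IdealSheafData :=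
  (Spec.map (CommRingCat.ofHom (Ideal.Quotient.mk (Ideal.span {g}))) ≫ f).ker

theorem mem_multiplesIdeal [QuasiSeparatedSpace X] {R : CommRingCat.{u}} {U : X.affineOpens}
    (φ : Γ(X, U) ⟶ R) (g : R) (a : Γ(X, U)) :
    a ∈ (multiplesIdeal (Spec.map φ ≫ (isAffineOpen_coe U).fromSpec) g).ideal U ↔ g ∣ φ a := by
  let q := CommRingCat.ofHom (Ideal.Quotient.mk (Ideal.span {g}))
  let f := Spec.map (φ ≫ q) ≫ (isAffineOpen_coe U).fromSpec
  have hf : multiplesIdeal (Spec.map φ ≫ (isAffineOpen_coe U).fromSpec) g = f.ker := by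
    rw [multiplesIdeal, ← Category.assoc, ← Spec.map_comp]
  have hle : (⊤ : (Spec (.of (R ⧸ Ideal.span {g}))).Opens) ≤ f ⁻¹ᵁ U.1 := by
    intro y _
    change U.2.fromSpec (Spec.map (φ ≫ q) y) ∈ U.1
    exact U.2.range_fromSpec.le ⟨_, rfl⟩
  have hker : ∀ (V : (Spec (.of (R ⧸ Ideal.span {g}))).Opens) (hV : V ≤ f ⁻¹ᵁ U.1),
      f ⁻¹ᵁ U.1 = V → (f.app U a = 0 ↔ f.appLE U V hV a = 0) := by
    rintro V hV rfl
    rw [Scheme.Hom.app_eq_appLE]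
  rw [hf, Scheme.Hom.ker_apply, RingHom.mem_ker]
  refine (hker ⊤ hle (top_le_iff.1 hle)).trans ?_
  rw [SpecMap_fromSpec_appLE, ← Ideal.mem_span_singleton, ← Ideal.Quotient.eq_zero_iff_mem]
  exact map_eq_zero_iff (Scheme.ΓSpecIso (.of (R ⧸ Ideal.span {g}))).inv.hom
    (Scheme.ΓSpecIso (.of (R ⧸ Ideal.span {g}))).symm.commRingCatIsoToRingEquiv.injective

/-- The image of the coordinate ring of the chart in `R` is contained in the image of the local
ring of the blow-up at the center of `Spec R`. -/
theorem exists_stalkClosedPointTo_eq {I : X.IdealSheafData} {R : CommRingCat.{u}} [IsLocalRing R]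
    (c : Chart I) (β : c.ring ⟶ R) (b : c.ring) :
    ∃ a, (Scheme.stalkClosedPointTo (Spec.map β ≫ chartι c)).hom a = β b := by
  let y := Spec.map β (IsLocalRing.closedPoint R)
  have h1 : (Scheme.stalkClosedPointTo (Spec.map β)).hom ((Spec c.ring).presheaf.germ ⊤ y trivial
      ((Scheme.ΓSpecIso c.ring).inv b)) = β b := by
    have := congrArg (fun t : Γ(Spec c.ring, ⊤) ⟶ R => t.hom ((Scheme.ΓSpecIso c.ring).inv b))
      (Scheme.germ_stalkClosedPointTo_Spec β)
    refine Eq.trans this ?_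
    change β (((Scheme.ΓSpecIso c.ring).inv ≫ (Scheme.ΓSpecIso c.ring).hom) b) = β b
    rw [Iso.inv_hom_id]
    rfl
  obtain ⟨a, ha⟩ := (asIso ((chartι c).stalkMap y)).commRingCatIsoToRingEquiv.surjective
    ((Spec c.ring).presheaf.germ ⊤ y trivial ((Scheme.ΓSpecIso c.ring).inv b))
  refine ⟨a, Eq.trans ?_ h1⟩
  rw [← ha, Scheme.stalkClosedPointTo_comp]
  rfl

end BlowupConstruction

open BlowupConstruction

/-- The blow-up along the ideal sheaf of the sections that are multiples of `g` in the valuation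
ring: the residue field of the center contains the residue classes of all the fractions `h / g` in
the valuation ring. -/
theorem BerkovichPoint.CenterOn.exists_blowup {k : Type u} [Field k] {X : Scheme.{u}}
    [QuasiSeparatedSpace X] {s : X ⟶ Spec (.of k)} {x : BerkovichPoint s} (c : x.CenterOn (𝟙 X))
    {U : X.affineOpens} (φ : Γ(X, U) ⟶ .of x.integers)
    (hφ : c.hom = Spec.map φ ≫ (isAffineOpen_coe U).fromSpec) {g : Γ(X, U)} (hg : φ g ≠ 0) :
    ∃ I : X.IdealSheafData, I ≠ ⊥ ∧ ∃ c' : x.CenterOn (blowupProj I),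
      ∀ h z, φ h = φ g * z → IsLocalRing.residue x.integers z ∈ c'.residueMap.fieldRange := by
  let I := multiplesIdeal (Spec.map φ ≫ (isAffineOpen_coe U).fromSpec) (φ g)
  have hI : ∀ a, a ∈ I.ideal U ↔ φ g ∣ φ a := mem_multiplesIdeal φ (φ g)
  let d : Chart I := ⟨U, {g}, Set.finite_singleton g, Set.singleton_nonempty g, by
    rintro _ rfl; exact (hI _).2 dvd_rfl⟩
  have hg' : φ g ∈ nonZeroDivisors x.integers := mem_nonZeroDivisors_of_ne_zero hg
  obtain ⟨β, hβ, -⟩ := existsUnique_blowupAlgebra_lift (J := I.ideal U) (S := {g}) φ.hom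
    (by rintro _ rfl; exact hg') (by rintro _ rfl h hh; exact (hI h).1 hh)
  let β' : d.ring ⟶ .of x.integers := CommRingCat.ofHom β
  have hβ' : d.structureMap ≫ β' = φ := CommRingCat.hom_ext hβ
  let c' : x.CenterOn (blowupProj I) := ⟨Spec.map β' ≫ chartι d, by
    have h := c.comm
    rw [Category.comp_id] at h
    rw [Category.assoc, chartι_blowupProj, Chart.proj, ← Spec.map_comp_assoc, hβ', ← h, hφ]⟩
  refine ⟨I, ?_, c', fun h z hz => ?_⟩
  · intro hbot
    have h1 : g ∈ I.ideal U := (hI g).2 dvd_rfl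
    rw [hbot, Scheme.IdealSheafData.ideal_bot] at h1
    have h2 : g = 0 := h1
    rw [h2, map_zero] at hg
    exact hg rfl
  · obtain ⟨b, hb⟩ := blowupAlgebra_exists_mul_eq (J := I.ideal U) (S := {g})
      (Set.mem_singleton g) ((hI h).2 ⟨z, hz⟩)
    have hbz : β b = z := by
      have h1 := congrArg β hb
      rw [map_mul] at h1
      have h2 : ∀ a, β (algebraMap _ _ a) = φ a := RingHom.congr_fun hβ
      rw [h2, h2, hz, mul_comm] at h1
      exact mul_left_cancel₀ hg h1
    obtain ⟨a, ha⟩ := exists_stalkClosedPointTo_eq d β' b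
    refine ⟨IsLocalRing.residue _ a, ?_⟩
    exact congrArg (IsLocalRing.residue x.integers) (ha.trans hbz)

/-! ### Double residue fields of monomial valuations -/

namespace BerkovichPoint.IsMonomial

variable {k : Type u} [Field k] {X : Scheme.{u}} [IsIntegral X] {s : X ⟶ Spec (.of k)}
  {x : BerkovichPoint s} {p : X} {m : ℕ} {D : CohenCoordinates X p m} {r : Fin m → ℝ}

/-- The residue map of any local homomorphism `𝒪_{X,p} → ℋ(x)°` given by evaluation is compatible
with the monomial embedding. -/
theorem isCompatible_embedding (hx : x.IsMonomial D r)
    (f : X.presheaf.stalk p →+* x.integers) [IsLocalHom f]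
    (hf : ∀ a, (f a : x.H) = hx.embedding.toField a) :
    letI : Algebra (X.residueField p) x.DoubleResidueField :=
      (IsLocalRing.ResidueField.map f).toAlgebra
    hx.embedding.IsCompatible := by
  intro a
  rw [← hf, normReduction_coe]
  rfl

theorem rank_valueSpace (hx : x.IsMonomial D r) {n : ℕ}
    (hn : Module.rank ℚ (Submodule.span ℚ (Set.range fun i => Real.log (r i))) = n) :
    Module.rank ℚ x.valueSpace = n := by
  have h : x.valueSpace = Submodule.span ℚ (Set.range fun i => Real.log (r i)) :=
    hx.embedding.span_log_norm
  rw [h, hn]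

theorem mem_integers_laurentMonomial (hx : x.IsMonomial D r) (I : weightRelations r) :
    x.laurentMonomial hx.specializes D I.1 ∈ x.integers :=
  (x.mem_integers _).2 (hx.embedding.norm_laurent I).le

end BerkovichPoint.IsMonomial

/-- Finitely many germs at a point are germs of sections over a common affine open. -/
theorem AlgebraicGeometry.Scheme.exists_affine_germ_eq {X : Scheme.{u}} (p : X) {ι : Type*}
    [Finite ι] (a : ι → X.presheaf.stalk p) :
    ∃ (U : X.affineOpens) (hp : p ∈ U.1) (t : ι → Γ(X, U)),
      ∀ i, X.presheaf.germ U p hp (t i) = a i := by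
  choose V hV t ht using fun i => X.presheaf.exists_germ_eq (a i)
  obtain ⟨_, ⟨U, hU, rfl⟩, hp, hle⟩ := X.isBasis_affineOpens.exists_subset_of_mem_open
    (Set.mem_iInter.2 hV) (isOpen_iInter_of_finite fun i => (V i).2)
  have hUV : ∀ i, U ≤ V i := fun i => hle.trans (Set.iInter_subset _ i)
  refine ⟨⟨U, hU⟩, hp, fun i => X.presheaf.map (homOfLE (hUV i)).op (t i), fun i => ?_⟩
  exact (X.presheaf.germ_res_apply (homOfLE (hUV i)) p hp (t i)).trans (ht i)

theorem AlgebraicGeometry.IsAffineOpen.exists_germ_mul_eq {X : Scheme.{u}} {p : X} {U : X.Opens}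
    (hU : IsAffineOpen U) (hp : p ∈ U) (a : X.presheaf.stalk p) : ∃ u v : Γ(X, U),
      IsUnit (X.presheaf.germ U p hp v) ∧
        a * X.presheaf.germ U p hp v = X.presheaf.germ U p hp u := by
  let := TopCat.Presheaf.algebra_section_stalk X.presheaf ⟨p, hp⟩
  have := hU.isLocalization_stalk ⟨p, hp⟩
  obtain ⟨⟨u, v⟩, h⟩ := IsLocalization.surj (hU.primeIdealOf ⟨p, hp⟩).asIdeal.primeCompl a
  exact ⟨u, v, IsLocalization.map_units (X.presheaf.stalk p) v, h⟩

/-- Some blow-up of `X` has a center whose residue field is the whole double residue field. The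
denominator `g` is a monomial such that the products of `g` with the Laurent monomials in a basis of
the group of relations are monomials too. -/
theorem BerkovichPoint.IsMonomial.exists_blowup {k : Type u} [Field k] {X : Scheme.{u}}
    [QuasiSeparatedSpace X] {s : X ⟶ Spec (.of k)} [IsIntegral X]
    {p : X} {m : ℕ} {D : CohenCoordinates X p m} {r : Fin m → ℝ}
    {x : BerkovichPoint s} (hx : x.IsMonomial D r) :
    ∃ (X' : Scheme.{u}) (π : X' ⟶ X) (I : X.IdealSheafData), I ≠ ⊥ ∧ IsBlowup π I ∧
      ∃ c' : x.CenterOn π, Function.Bijective c'.residueMap := by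
  let E := hx.embedding
  have hE := hx.isCompatible_embedding hx.stalkToIntegers fun _ => rfl
  let _ : Algebra (X.residueField p) x.DoubleResidueField :=
    (IsLocalRing.ResidueField.map hx.stalkToIntegers).toAlgebra
  obtain ⟨-, d, -, -, ⟨b⟩⟩ := exists_basis_weightRelations r
  obtain ⟨N, w, hw⟩ := exists_add_nonneg (Finset.univ.image fun j => (b j).1)
  obtain ⟨U, hp, t, ht⟩ := Scheme.exists_affine_germ_eq p D.coord
  let φ : Γ(X, U) ⟶ .of x.integers :=
    X.presheaf.germ U p hp ≫ CommRingCat.ofHom hx.stalkToIntegers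
  have hφ : hx.centerOn.hom = Spec.map φ ≫ (isAffineOpen_coe U).fromSpec := by
    refine Eq.trans ?_ (congrArg (· ≫ (isAffineOpen_coe U).fromSpec)
      (Spec.map_comp (X.presheaf.germ U p hp) (CommRingCat.ofHom hx.stalkToIntegers)).symm)
    refine Eq.trans ?_ (Category.assoc _ _ _).symm
    exact congrArg (Spec.map (CommRingCat.ofHom hx.stalkToIntegers) ≫ ·)
      ((isAffineOpen_coe U).fromSpecStalk_eq_fromSpecStalk hp).symm
  let mon : (Fin m →₀ ℕ) → Γ(X, U) := fun I => ∏ i, t i ^ I i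
  have hmon : ∀ I, (φ (mon I)).1 = E.toField (E.monomial I) := fun I => by
    have h1 : X.presheaf.germ U p hp (mon I) = E.monomial I := by
      rw [map_prod]
      exact Finset.prod_congr rfl fun i _ => by rw [map_pow, ht]; rfl
    exact congrArg E.toField h1
  have hmon0 : φ (mon N) ≠ 0 := fun h0 => by
    have h1 := hmon N
    rw [h0, ← E.laurent_natCast] at h1
    exact E.laurent_ne_zero _ h1.symm
  obtain ⟨I, hI, c', hc'⟩ := hx.centerOn.exists_blowup φ hφ hmon0
  refine ⟨_, blowupProj I, I, hI, isBlowup_blowupProj I, c', c'.residueMap.injective, ?_⟩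
  have hsec : ∀ u, IsLocalRing.residue x.integers (φ u) ∈ c'.residueMap.fieldRange := fun u =>
    hc' (mon N * u) _ (map_mul φ.hom _ _)
  -- `K` contains `κ(p)`, as elements of `𝒪_{X,p}` are quotients of sections over `U`
  let K : IntermediateField (X.residueField p) x.DoubleResidueField :=
    c'.residueMap.fieldRange.toIntermediateField fun a => by
      obtain ⟨a, rfl⟩ := X.residue_surjective p a
      obtain ⟨u, v, hv, h⟩ := (isAffineOpen_coe U).exists_germ_mul_eq hp a
      have h1 : IsLocalRing.residue x.integers (hx.stalkToIntegers a) *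
          IsLocalRing.residue x.integers (φ v) = IsLocalRing.residue x.integers (φ u) := by
        rw [← map_mul]
        refine congrArg _ (Eq.trans ?_ (congrArg hx.stalkToIntegers h))
        exact (map_mul hx.stalkToIntegers _ _).symm
      have h2 : IsLocalRing.residue x.integers (φ v) ≠ 0 :=
        ((hv.map hx.stalkToIntegers).map (IsLocalRing.residue x.integers)).ne_zero
      have h3 := eq_div_of_mul_eq h2 h1
      change IsLocalRing.residue x.integers (hx.stalkToIntegers a) ∈ c'.residueMap.fieldRange
      rw [h3]
      exact div_mem (hsec u) (hsec v)
  have hK : K = ⊤ := MonomialEmbedding.eq_top_of_mem (E := E) b hE K fun j => by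
    suffices h : IsLocalRing.residue x.integers ⟨_, hx.mem_integers_laurentMonomial (b j)⟩ ∈
        c'.residueMap.fieldRange by
      have h1 : normReduction (E.laurent (b j).1) ∈ c'.residueMap.fieldRange :=
        (normReduction_of_le (E.norm_laurent (b j)).le).symm ▸ h
      exact h1
    refine hc' (mon (w (b j).1)) _ (Subtype.ext ?_)
    refine (hmon _).trans (Eq.trans ?_ (congrArg (· * E.laurent (b j).1) (hmon N).symm))
    rw [← E.laurent_natCast, ← E.laurent_natCast, ← E.laurent_add]
    congr 1
    funext i
    rw [hw _ (Finset.mem_image_of_mem _ (Finset.mem_univ j)), add_comm]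
    rfl
  exact fun z => (show z ∈ K from hK ▸ IntermediateField.mem_top)

end

theorem theorem4p6 {k : Type u} [Field k] {X : Scheme.{u}} (s : X ⟶ Spec (.of k))
    [IsIntegral X] [IsSeparated s] [LocallyOfFiniteType s] [QuasiCompact s]
    (p : X) [IsRegularLocalRing (X.presheaf.stalk p)]
    {m : ℕ} (D : CohenCoordinates X p m) (r : Fin m → ℝ)
    (x : BerkovichPoint s) (hx : x.IsMonomial D r) :
    -- the center of `x` on `X` exists and is `p`
    ∃ c : x.CenterOn (𝟙 X), c.center = p ∧
      (letI : Algebra (X.residueField c.center) x.DoubleResidueField := c.residueMap.toAlgebra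
       -- finite generation over `κ(c_X(x))`
       (⊤ : IntermediateField (X.residueField c.center) x.DoubleResidueField).FG ∧
       -- the double residue field is the fraction field of the group ring of
       -- `{I ∈ ℤ^m | r^I = 1}`, with `I` corresponding to the residue class of `f^I`
       (∃ Ψ : AddMonoidAlgebra (X.residueField c.center) (weightRelations r)
            →ₐ[X.residueField c.center] x.DoubleResidueField,
          (∀ I : weightRelations r,
            ∃ h : x.laurentMonomial hx.specializes D I.1 ∈ x.integers,
              Ψ (AddMonoidAlgebra.single I 1) = IsLocalRing.residue x.integers ⟨_, h⟩) ∧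
          Function.Injective Ψ ∧
          ∀ z : x.DoubleResidueField, ∃ a b, b ≠ 0 ∧ z = Ψ a / Ψ b) ∧
       -- with `n` the rational rank, it is a rational function field in `m - n` variables
       ∃ n : ℕ, Module.rank ℚ x.valueSpace = n ∧ n ≤ m ∧
          Nonempty (x.DoubleResidueField ≃ₐ[X.residueField c.center]
            FractionRing (MvPolynomial (Fin (m - n)) (X.residueField c.center)))) ∧
      -- some blow-up of `X` realizes the double residue field as the residue field of the center
      ∃ (X' : Scheme.{u}) (π : X' ⟶ X) (I : X.IdealSheafData), I ≠ ⊥ ∧ IsBlowup π I ∧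
        ∃ c' : x.CenterOn π, Function.Bijective c'.residueMap := by
  have : QuasiSeparatedSpace X := (quasiSeparated_iff_quasiSeparatedSpace s).1 inferInstance
  obtain ⟨c, hc⟩ : ∃ c : x.CenterOn (𝟙 X), c.center = p := ⟨hx.centerOn, hx.centerOn_center⟩
  -- from here on `p` is `c.center`, so that the residue field of `p` acts through `c.residueMap`
  subst hc
  have hE := hx.isCompatible_embedding c.stalkToIntegers (c.coe_stalkToIntegers hx.specializes)
  let _ : Algebra (X.residueField c.center) x.DoubleResidueField := c.residueMap.toAlgebra
  obtain ⟨n, d, hnd, hn, ⟨b⟩⟩ := exists_basis_weightRelations r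
  refine ⟨c, rfl, ⟨MonomialEmbedding.fg_top (E := hx.embedding) b hE,
    ⟨hx.embedding.groupRingHom, fun I => ⟨hx.mem_integers_laurentMonomial I, ?_⟩,
      MonomialEmbedding.groupRingHom_injective hE, MonomialEmbedding.exists_div_eq hE⟩,
    n, hx.rank_valueSpace hn, by omega, ?_⟩, hx.exists_blowup⟩
  · refine (hx.embedding.groupRingHom_single I 1).trans ?_
    rw [map_one, one_mul]
    exact normReduction_coe ⟨_, hx.mem_integers_laurentMonomial I⟩
  · obtain rfl : d = m - n := by omega
    exact MonomialEmbedding.nonempty_algEquiv (E := hx.embedding) b hE
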